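/- Let $\mathbb K$ be an algebraically closed field and let $\mathbf q=(q_{ij})$ be an $n\times n$ matrix over $\mathbb K^*$ with $q_{ii}=1$ and $q_{ji}=q_{ij}^{-1}$. Let $\mathcal O_{\mathbf q}(\mathbb K^n)$ be the $\mathbb K$-algebra generated by $x_1,\dots,x_n$ with relations $x_ix_j=q_{ij}x_jx_i$, and let $\mathbb A_{\mathbf q}$ (the quantum torus) be the $\mathbb K$-algebra generated by $x_1^{\pm1},\dots,x_n^{\pm1}$ with the same relations. Assume that the $q_{ij}$ generate a finite (hence cyclic) subgroup of $\mathbb K^*$, of order $m$, and let $q$ be a generator of it. Modules are right modules. A normal form of $\mathbb A_{\mathbf q}$ consists of an integer $s\ge 0$ with $2s\le n$, divisors $h_1=1\mid h_2\mid\dots\mid h_s$ of $m$ with $h_i\ne m$ for $i\ge2$, an integer $z\ge1$ with $\operatorname{ord}(q^{zh_s})=\operatorname{ord}(q^{h_s})$ (if $s\ge 1$) and with $z=1$ if $2s<n$, and an isomorphism of $\mathbb K$-algebras $$\mathbb A_{\mathbf q}\cong \mathbb A_{c_1}\otimes\cdots\otimes\mathbb A_{c_s}\otimes\mathbb K[\mathbb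 Z^{n-2s}],\qquad c_i=q^{h_i}\ (i<s),\quad c_s=q^{zh_s},$$ where $\mathbb A_{c_i}$ is generated by $X_i^{\pm1},X_{i+s}^{\pm1}$ with $X_iX_{i+s}=c_iX_{i+s}X_i$, and $\mathbb K[\mathbb Z^{n-2s}]$ is generated by $X_{2s+1}^{\pm1},\dots,X_n^{\pm1}$. Put $k_i=m/h_i$. For $\alpha\in(\mathbb K^*)^n$ let $M(\alpha)$ be the $\mathbb A_{\mathbf q}$-module with $\mathbb K$-basis $e(a_1,\dots,a_s)$, $0\le a_i\le k_i-1$, and action $$e(a)X_i=\alpha_i\,e(\dots,a_i+1,\dots),\qquad e(a)X_{i+s}=\alpha_i^{-1}\alpha_{i+s}\,c_i^{\,a_i-1}\,e(\dots,a_i-1,\dots),\qquad e(a)X_{2s+j}=\alpha_{2s+j}\,e(a)$$ for $1\le i\le s$ and $1\le j\le n-2s$, where $a_i\pm1$ is taken modulo $k_i$. Then $\mathbb A_{\mathbf q}$ has a normal form. Moreover, for every normal form the following hold. Let $N$ be a simple $\mathcal O_{\mathbf q}(\mathbb K^n)$-module on which every $x_i$ acts nontrivially (i.e. $Nx_i\neq0$).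 Then the module structure of $N$ extends uniquely to an $\mathbb A_{\mathbf q}$-module structure; with it $N$ is a simple $\mathbb A_{\mathbf q}$-module, and $N\cong M(\alpha)$ as an $\mathbb A_{\mathbf q}$-module for some $\alpha\in(\mathbb K^*)^n$. Conversely, each $M(\alpha)$, $\alpha\in(\mathbb K^*)^n$, is simple as an $\mathcal O_{\mathbf q}(\mathbb K^n)$-module, and every $x_i$ acts nontrivially on it; thus $\alpha\mapsto M(\alpha)$ is a surjection from $(\mathbb K^*)^n$ onto the set of isomorphism classes of simple $\mathcal O_{\mathbf q}(\mathbb K^n)$-modules on which all $x_i$ act nontrivially. -/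

import Mathlib

open MulOpposite

noncomputable section

namespace QuantumSpace

universe u

section Algebras

variable {K : Type u} [Field K] {ι : Type} (q : Matrix ι ι Kˣ)

/-- A matrix of nonzero scalars is multiplicatively antisymmetric if `q i i = 1` for all `i` and
`q j i = (q i j)⁻¹` for all `i ≠ j`. -/
def MultAntisymm : Prop :=
  (∀ i, q i i = 1) ∧ ∀ i j, i ≠ j → q j i = (q i j)⁻¹

/-- The subgroup of `Kˣ` generated by the entries of `q`. -/
def paramGroup : Subgroup Kˣ :=
  Subgroup.closure (Set.range fun p : ι × ι => q p.1 p.2)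

/-- The defining relations `x i * x j = q i j • (x j * x i)` of the quantum affine space. -/
inductive AffineRel : FreeAlgebra K ι → FreeAlgebra K ι → Prop
  | comm (i j : ι) : AffineRel (FreeAlgebra.ι K i * FreeAlgebra.ι K j)
      ((q i j : K) • (FreeAlgebra.ι K j * FreeAlgebra.ι K i))

/-- The coordinate ring of quantum affine space with parameter matrix `q`. -/
def QuantumAffine : Type u := RingQuot (AffineRel q)

instance : Ring (QuantumAffine q) := inferInstanceAs (Ring (RingQuot (AffineRel q)))

instance : Algebra K (QuantumAffine q) := inferInstanceAs (Algebra K (RingQuot (AffineRel q)))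

/-- The generators of the quantum affine space. -/
def QuantumAffine.x (i : ι) : QuantumAffine q :=
  RingQuot.mkAlgHom K (AffineRel q) (FreeAlgebra.ι K i)

/-- The defining relations of the quantum torus. The generators are `x i`, indexed by
`Sum.inl i`, and their inverses, indexed by `Sum.inr i`. -/
inductive TorusRel : FreeAlgebra K (ι ⊕ ι) → FreeAlgebra K (ι ⊕ ι) → Prop
  | comm (i j : ι) : TorusRel (FreeAlgebra.ι K (Sum.inl i) * FreeAlgebra.ι K (Sum.inl j))
      ((q i j : K) • (FreeAlgebra.ι K (Sum.inl j) * FreeAlgebra.ι K (Sum.inl i)))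
  | mul_inv (i : ι) : TorusRel (FreeAlgebra.ι K (Sum.inl i) * FreeAlgebra.ι K (Sum.inr i)) 1
  | inv_mul (i : ι) : TorusRel (FreeAlgebra.ι K (Sum.inr i) * FreeAlgebra.ι K (Sum.inl i)) 1

/-- The quantum torus with parameter matrix `q`: the algebra generated by the `x i` together with
their inverses, subject to the relations `x i * x j = q i j • (x j * x i)`. -/
def QuantumTorus : Type u := RingQuot (TorusRel q)

instance : Ring (QuantumTorus q) := inferInstanceAs (Ring (RingQuot (TorusRel q)))

instance : Algebra K (QuantumTorus q) := inferInstanceAs (Algebra K (RingQuot (TorusRel q)))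

/-- The generators of the quantum torus. -/
def QuantumTorus.x (i : ι) : QuantumTorus q :=
  RingQuot.mkAlgHom K (TorusRel q) (FreeAlgebra.ι K (Sum.inl i))

/-- The canonical map from the quantum affine space to the quantum torus, `x i ↦ x i`. -/
def toTorus : QuantumAffine q →ₐ[K] QuantumTorus q :=
  RingQuot.liftAlgHom K ⟨FreeAlgebra.lift K (QuantumTorus.x q), by
    rintro _ _ ⟨i, j⟩
    simp only [map_mul, map_smul, FreeAlgebra.lift_ι_apply, QuantumTorus.x]
    have h := RingQuot.mkAlgHom_rel K (TorusRel.comm (q := q) i j)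
    rw [map_mul, map_smul, map_mul] at h
    exact h⟩

variable {q}

/-- The algebra map out of the quantum torus determined by invertible elements that satisfy
the commutation relations. -/
def QuantumTorus.lift {B : Type*} [Ring B] [Algebra K B] (f : ι → Bˣ)
    (hf : ∀ i j, (f i * f j : B) = (q i j : K) • (f j * f i : B)) : QuantumTorus q →ₐ[K] B :=
  RingQuot.liftAlgHom K
    ⟨FreeAlgebra.lift K (Sum.elim (fun i => (f i : B)) fun i => ((f i)⁻¹ : Bˣ)), by
      rintro _ _ (⟨i, j⟩ | i | i)
      · simpa using hf i j
      · simp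
      · simp⟩

end Algebras

section WeightedShift

variable {K : Type u} [Field K] {I : Type} [AddCommGroup I]

/-- The linear map `e a ↦ w a • e (a + d)` on the vector space with basis `e a`, `a : I`. -/
def shiftMap (w : I → Kˣ) (d : I) : Module.End K (I →₀ K) :=
  Finsupp.linearCombination K fun a => Finsupp.single (a + d) (w a : K)

lemma shiftMap_single (w : I → Kˣ) (d a : I) (r : K) :
    shiftMap w d (Finsupp.single a r) = Finsupp.single (a + d) (r * w a) := by
  simp [shiftMap]

/-- The map `e a ↦ w a • e (a + d)` as an invertible operator acting from the right. -/
def shiftUnit (w : I → Kˣ) (d : I) : ((Module.End K (I →₀ K))ᵐᵒᵖ)ˣ where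
  val := op (shiftMap w d)
  inv := op (shiftMap (fun a => (w (a - d))⁻¹) (-d))
  val_inv := by
    rw [← op_mul, ← op_one]
    congr 1
    ext a b
    simp [shiftMap_single]
  inv_val := by
    rw [← op_mul, ← op_one]
    congr 1
    ext a b
    simp [shiftMap_single, sub_eq_add_neg]

lemma shiftUnit_comm (w w' : I → Kˣ) (d d' : I) (r : Kˣ)
    (h : ∀ a, w a * w' (a + d) = r * (w' a * w (a + d'))) :
    (shiftUnit w d * shiftUnit w' d' : (Module.End K (I →₀ K))ᵐᵒᵖ) =
      (r : K) • (shiftUnit w' d' * shiftUnit w d : (Module.End K (I →₀ K))ᵐᵒᵖ) := by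
  simp only [shiftUnit, ← op_mul, ← op_smul]
  congr 1
  refine Finsupp.lhom_ext fun a t => ?_
  have h' := congrArg (Units.val) (h a)
  simp only [Units.val_mul] at h'
  simp only [Module.End.mul_apply, LinearMap.smul_apply, shiftMap_single, Finsupp.smul_single,
    smul_eq_mul, add_right_comm a d' d]
  congr 1
  rw [mul_assoc, h']
  ring

end WeightedShift

section Model

variable {K : Type u} [Field K] {s t : ℕ}

/-- Indices of the generators of a tensor product of `s` quantum tori of rank two with the group
algebra of `ℤ ^ t`. The pair `Sum.inl i`, `Sum.inr (Sum.inl i)` belongs to the `i`-th quantum torus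
of rank two, and `Sum.inr (Sum.inr j)` to the group algebra. -/
abbrev BlockIndex (s t : ℕ) : Type := Fin s ⊕ (Fin s ⊕ Fin t)

/-- The parameter matrix of the tensor product of the quantum tori of rank two given by
`X * Y = c i • (Y * X)`, for `i : Fin s`, and of the group algebra of `ℤ ^ t`: generators that belong
to different factors commute. -/
def blockMatrix (c : Fin s → Kˣ) : Matrix (BlockIndex s t) (BlockIndex s t) Kˣ
  | Sum.inl i, Sum.inr (Sum.inl j) => if i = j then c i else 1
  | Sum.inr (Sum.inl i), Sum.inl j => if i = j then (c i)⁻¹ else 1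
  | _, _ => 1

/-- The displacement `d` in the rule that the generator sends `e a` to a multiple of `e (a + d)`. -/
def blockShift (k : Fin s → ℕ) : BlockIndex s t → ∀ i, ZMod (k i)
  | Sum.inl i => Pi.single i 1
  | Sum.inr (Sum.inl i) => Pi.single i (-1)
  | Sum.inr (Sum.inr _) => 0

/-- The coefficient in the rule that the generator sends `e a` to a multiple of `e (a + d)`. The
cast is the representative of `a i` in `{0, …, k i - 1}`. -/
def blockCoeff (k : Fin s → ℕ) (c : Fin s → Kˣ) (α : BlockIndex s t → Kˣ) :
    BlockIndex s t → (∀ i, ZMod (k i)) → Kˣ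
  | Sum.inl i, _ => α (Sum.inl i)
  | Sum.inr (Sum.inl i), a =>
      (α (Sum.inl i))⁻¹ * α (Sum.inr (Sum.inl i)) * c i ^ (((a i).cast : ℤ) - 1)
  | Sum.inr (Sum.inr j), _ => α (Sum.inr (Sum.inr j))

lemma zpow_cast_add {k : ℕ} {c : Kˣ} (hc : c ^ k = 1) (x : ZMod k) (y : ℤ) :
    c ^ ((x + y : ZMod k).cast : ℤ) = c ^ (x.cast + y : ℤ) := by
  have h : (((x + y : ZMod k).cast : ℤ) : ZMod k) = ((x.cast + y : ℤ) : ZMod k) := by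
    push_cast
    simp
  rw [ZMod.intCast_eq_intCast_iff_dvd_sub] at h
  obtain ⟨r, hr⟩ := h
  rw [eq_add_of_sub_eq hr, zpow_add, zpow_mul, zpow_natCast, hc, one_zpow, one_mul]

lemma block_comm (k : Fin s → ℕ) (c : Fin s → Kˣ) (hc : ∀ i, c i ^ k i = 1)
    (α : BlockIndex s t → Kˣ) (x y : BlockIndex s t) (a : ∀ i, ZMod (k i)) :
    blockCoeff k c α x a * blockCoeff k c α y (a + blockShift k x) =
      blockMatrix c x y * (blockCoeff k c α y a * blockCoeff k c α x (a + blockShift k y)) := by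
  have key (i : Fin s) : c i ^ (((a i + 1).cast : ℤ) - 1) = c i * c i ^ (((a i).cast : ℤ) - 1) := by
    have h := zpow_cast_add (hc i) (a i) 1
    rw [Int.cast_one] at h
    rw [zpow_sub, h, ← zpow_sub, ← zpow_one_add]
    congr 1
    ring
  rcases x with i | i | i <;> rcases y with j | j | j <;>
    simp only [blockCoeff, blockShift, blockMatrix, one_mul, add_zero, Pi.add_apply, Pi.zero_apply]
  · exact mul_comm _ _
  · split_ifs with h
    · subst h
      rw [Pi.single_eq_same, key]
      simp only [mul_assoc, mul_comm, mul_left_comm]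
    · rw [Pi.single_eq_of_ne (Ne.symm h), add_zero, one_mul]
      simp only [mul_comm]
  · exact mul_comm _ _
  · split_ifs with h
    · subst h
      rw [Pi.single_eq_same, key]
      rw [eq_inv_mul_iff_mul_eq]
      simp only [mul_assoc, mul_comm, mul_left_comm]
    · rw [Pi.single_eq_of_ne h, add_zero, one_mul]
      simp only [mul_comm]
  · rcases eq_or_ne i j with h | h
    · subst h
      rfl
    · rw [Pi.single_eq_of_ne h, Pi.single_eq_of_ne (Ne.symm h), add_zero, add_zero]
      exact mul_comm _ _
  all_goals exact mul_comm _ _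

/-- The right action of the quantum torus with parameter matrix `blockMatrix c` on the vector space
with basis `e a`, `a : ∀ i, ZMod (k i)`, given by
* `e a * X i = α i • e (a + single i 1)`,
* `e a * Y i = ((α i)⁻¹ * α (s + i) * c i ^ (a i - 1)) • e (a - single i 1)`,
* `e a * Z j = α (2 s + j) • e a`. -/
def blockRep (k : Fin s → ℕ) (c : Fin s → Kˣ) (hc : ∀ i, c i ^ k i = 1)
    (α : BlockIndex s t → Kˣ) :
    QuantumTorus (blockMatrix (t := t) c) →ₐ[K] (Module.End K ((∀ i, ZMod (k i)) →₀ K))ᵐᵒᵖ :=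
  QuantumTorus.lift (B := (Module.End K ((∀ i, ZMod (k i)) →₀ K))ᵐᵒᵖ)
    (fun x => shiftUnit (blockCoeff k c α x) (blockShift k x))
    fun x y => shiftUnit_comm _ _ _ _ _ (block_comm k c hc α x y)

end Model

section NormalForms

variable {K : Type u} [Field K] {n : ℕ}

/-- The exponents `h 1, …, h (s-1), z * h s` of the rank two factors. -/
def exponent {s : ℕ} (h : Fin s → ℕ) (z : ℕ) (i : Fin s) : ℕ :=
  if i.val + 1 = s then z * h i else h i

/-- A normal form of the quantum torus with parameter matrix `q`, relative to the generator `ζ` of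
the group of parameters: an isomorphism of this quantum torus with the tensor product of the rank
two quantum tori with parameters `ζ ^ h 1, …, ζ ^ h (s-1), ζ ^ (z * h s)` and of the group algebra
of `ℤ ^ (n - 2 s)`, where `h 1 = 1`, the `h i` are divisors of the order of `ζ`, nonzero modulo
this order for `i ≥ 2`, each divides the next one, and `z = 1` unless `2 s = n`.
The index set `Fin s` starts at `0`. -/
structure NormalForm (q : Matrix (Fin n) (Fin n) Kˣ) (ζ : Kˣ) where
  s : ℕ
  two_mul_le : 2 * s ≤ n
  h : Fin s → ℕ
  h_dvd_order : ∀ i, h i ∣ orderOf ζ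
  h_first : ∀ i, i.val = 0 → h i = 1
  h_ne_zero : ∀ i, i.val ≠ 0 → ¬ orderOf ζ ∣ h i
  h_dvd : ∀ i j, i ≤ j → h i ∣ h j
  z : ℕ
  z_pos : 0 < z
  z_eq_one : 2 * s < n → z = 1
  z_order : ∀ i : Fin s, i.val + 1 = s → orderOf (ζ ^ (z * h i)) = orderOf (ζ ^ h i)
  iso : QuantumTorus (blockMatrix (t := n - 2 * s) fun i => ζ ^ exponent h z i) ≃ₐ[K]
    QuantumTorus q

namespace NormalForm

variable {q : Matrix (Fin n) (Fin n) Kˣ} {ζ : Kˣ} (F : NormalForm q ζ)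

/-- The numbers `k i = m / h i`, where `m` is the order of `ζ`. -/
def k (i : Fin F.s) : ℕ := orderOf ζ / F.h i

/-- The parameters of the rank two factors. -/
abbrev c : Fin F.s → Kˣ := fun i => ζ ^ exponent F.h F.z i

lemma c_pow_k (i : Fin F.s) : F.c i ^ F.k i = 1 := by
  have h : ζ ^ (F.h i * F.k i) = 1 := by
    rw [k, Nat.mul_div_cancel' (F.h_dvd_order i), pow_orderOf_eq_one]
  change (ζ ^ exponent F.h F.z i) ^ F.k i = 1
  unfold exponent
  split_ifs
  · rw [← pow_mul, mul_assoc, mul_comm, pow_mul, h, one_pow]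
  · rw [← pow_mul, h]

/-- The numbering `X 1, …, X n` of the generators of the normal form: `i ↦ i` and `i ↦ s + i` for
the two generators of the `i`-th factor of rank two, `j ↦ 2 s + j` for the group algebra. -/
def idx : BlockIndex F.s (n - 2 * F.s) → Fin n
  | Sum.inl i => ⟨i, by have := F.two_mul_le; omega⟩
  | Sum.inr (Sum.inl i) => ⟨i + F.s, by have := F.two_mul_le; omega⟩
  | Sum.inr (Sum.inr j) => ⟨2 * F.s + j, by have := F.two_mul_le; omega⟩

/-- The vector space `M(α)`, with basis `e a` for `a : ∀ i, ZMod (k i)`. -/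
def Model (_α : Fin n → Kˣ) : Type u := (∀ i, ZMod (F.k i)) →₀ K

variable (α : Fin n → Kˣ)

instance : AddCommGroup (F.Model α) := inferInstanceAs (AddCommGroup ((∀ i, ZMod (F.k i)) →₀ K))

instance : Module K (F.Model α) := inferInstanceAs (Module K ((∀ i, ZMod (F.k i)) →₀ K))

/-- The right action of the quantum torus on `M(α)`, through the normal form. -/
def rep : QuantumTorus q →ₐ[K] (Module.End K (F.Model α))ᵐᵒᵖ :=
  (blockRep F.k F.c F.c_pow_k (α ∘ F.idx)).comp F.iso.symm.toAlgHom

/-- `M(α)` as a right module over the quantum torus. -/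
instance : Module (QuantumTorus q)ᵐᵒᵖ (F.Model α) :=
  Module.compHom (F.Model α) (AlgHom.opComm (F.rep α)).toRingHom

/-- `M(α)` as a right module over the quantum affine space, by restriction. -/
instance : Module (QuantumAffine q)ᵐᵒᵖ (F.Model α) :=
  Module.compHom (F.Model α) (AlgHom.op (toTorus q)).toRingHom

end NormalForm

/-- All variables act nontrivially on the right module `N`. -/
def VariablesActNontrivially (q : Matrix (Fin n) (Fin n) Kˣ) (N : Type*) [AddCommGroup N]
    [Module (QuantumAffine q)ᵐᵒᵖ N] : Prop :=
  ∀ i, ∃ v : N, op (QuantumAffine.x q i) • v ≠ 0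

/-- The given right module structure over the quantum torus extends the one over the quantum affine
space. -/
def ExtendsAction (q : Matrix (Fin n) (Fin n) Kˣ) (N : Type*) [AddCommGroup N]
    [Module (QuantumAffine q)ᵐᵒᵖ N] [Module (QuantumTorus q)ᵐᵒᵖ N] : Prop :=
  ∀ (a : QuantumAffine q) (v : N), op (toTorus q a) • v = op a • v

end NormalForms

end QuantumSpace

end

open QuantumSpace

/-!
Among all parameter matrices reachable from `q` by changes of generators `x k ↦ x k * x p ^ a k`,
choose an entry `ζ ^ h ≠ 1` with `h` minimal. By division with remainder, the row and the column of
this entry consist of powers of `ζ ^ h`, so that they can be cleared: two generators split off as a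
quantum torus of rank two, and induction applies to the remaining ones. As long as a third generator
is present, minimality also forces `h ∣ orderOf ζ`; only the last pair may need the correction `z`.

On a simple module over the quantum affine space the normal elements `x i` act as zero or
bijectively, which extends the action to the quantum torus. The powers `x i ^ orderOf ζ` are central
and the quantum torus is finite over the subalgebra they generate, so simple modules are
finite-dimensional. Choose a common eigenvector of the commuting products `X i * Y i` of the two
generators of each factor. By Schur's lemma the central elements `X i ^ k i` are scalars, so
rescaled `X i` move this eigenvector through a basis as in `M(α)`. Conversely, the `X i * Y i` act
diagonally on `M(α)` with pairwise distinct joint eigenvalues, so that a nonzero invariant subspace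
contains a basis vector, and hence all of them.
-/

noncomputable section

namespace QuantumSpace

universe u

section SkewCommute

variable {R B : Type*} [CommRing R] [Ring B] [Algebra R B] {r s : Rˣ} {u v w : B}

/-- `u` and `v` commute up to the invertible scalar `r`: `u * v = r • (v * u)`. -/
def SkewCommute (r : Rˣ) (u v : B) : Prop :=
  u * v = (r : R) • (v * u)

namespace SkewCommute

lemma eq (h : SkewCommute r u v) : u * v = (r : R) • (v * u) := h

lemma commute (h : SkewCommute (1 : Rˣ) u v) : Commute u v := by
  simpa [SkewCommute, commute_iff_eq] using h

protected lemma symm (h : SkewCommute r u v) : SkewCommute r⁻¹ v u := by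
  rw [SkewCommute, h.eq, smul_smul, Units.inv_mul, one_smul]

protected lemma op (h : SkewCommute r u v) :
    SkewCommute r (MulOpposite.op v) (MulOpposite.op u) :=
  unop_injective h.eq

protected lemma map {C : Type*} [Ring C] [Algebra R C] (h : SkewCommute r u v) (φ : B →ₐ[R] C) :
    SkewCommute r (φ u) (φ v) := by
  rw [SkewCommute, ← map_mul, h.eq, map_smul, map_mul]

lemma one_right (u : B) : SkewCommute (1 : Rˣ) u 1 := by
  simp [SkewCommute]

lemma mul_right (hv : SkewCommute r u v) (hw : SkewCommute s u w) :
    SkewCommute (r * s) u (v * w) := by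
  rw [SkewCommute, ← mul_assoc, hv.eq, smul_mul_assoc, mul_assoc, hw.eq, mul_smul_comm, smul_smul,
    mul_assoc, Units.val_mul]

lemma mul_left (hu : SkewCommute r u w) (hv : SkewCommute s v w) :
    SkewCommute (r * s) (u * v) w := by
  simpa [mul_comm r s] using (hu.symm.mul_right hv.symm).symm

lemma pow_right (h : SkewCommute r u v) : ∀ n : ℕ, SkewCommute (r ^ n) u (v ^ n)
  | 0 => by simpa using one_right u
  | n + 1 => by simpa only [pow_succ] using (h.pow_right n).mul_right h

lemma pow_left (h : SkewCommute r u v) (n : ℕ) : SkewCommute (r ^ n) (u ^ n) v := by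
  simpa using (h.symm.pow_right n).symm

lemma inv_right {v : Bˣ} (h : SkewCommute r u v) : SkewCommute r⁻¹ u ((v⁻¹ : Bˣ) : B) := by
  suffices (v⁻¹ : Bˣ) * u = (r : R) • (u * (v⁻¹ : Bˣ)) from SkewCommute.symm this
  rw [Units.inv_mul_eq_iff_eq_mul, mul_smul_comm, ← mul_assoc, ← smul_mul_assoc, ← h.eq,
    Units.mul_inv_cancel_right]

lemma inv_left {u : Bˣ} (h : SkewCommute r (u : B) v) :
    SkewCommute r⁻¹ ((u⁻¹ : Bˣ) : B) v := by
  simpa using h.symm.inv_right.symm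

lemma zpow_right {v : Bˣ} (h : SkewCommute r u v) :
    ∀ n : ℤ, SkewCommute (r ^ n) u ((v ^ n : Bˣ) : B)
  | (n : ℕ) => by simpa using h.pow_right n
  | Int.negSucc n => by
      simpa using (show SkewCommute r u v from h).inv_right.pow_right (n + 1)

lemma zpow_left {u : Bˣ} (h : SkewCommute r (u : B) v) (n : ℤ) :
    SkewCommute (r ^ n) ((u ^ n : Bˣ) : B) v := by
  simpa using (h.symm.zpow_right n).symm

end SkewCommute

end SkewCommute

section Generators

variable {K : Type u} [Field K] {ι κ : Type} {q : Matrix ι ι Kˣ}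

namespace QuantumAffine

lemma skewCommute_x (i j : ι) : SkewCommute (q i j) (x q i) (x q j) := by
  have h := RingQuot.mkAlgHom_rel K (AffineRel.comm (q := q) i j)
  rw [map_mul, map_smul, map_mul] at h
  exact h

lemma induction {P : QuantumAffine q → Prop}
    (algebraMap : ∀ r : K, P (algebraMap K _ r)) (x : ∀ i, P (x q i))
    (add : ∀ a b, P a → P b → P (a + b)) (mul : ∀ a b, P a → P b → P (a * b))
    (a : QuantumAffine q) : P a := by
  obtain ⟨y, rfl⟩ := RingQuot.mkAlgHom_surjective K (AffineRel q) a
  induction y using FreeAlgebra.induction with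
  | grade0 r => rw [AlgHom.commutes]; exact algebraMap r
  | grade1 i => exact x i
  | mul a b ha hb => rw [map_mul]; exact mul _ _ ha hb
  | add a b ha hb => rw [map_add]; exact add _ _ ha hb

end QuantumAffine

@[simp]
lemma toTorus_x (i : ι) : toTorus q (QuantumAffine.x q i) = QuantumTorus.x q i :=
  (RingQuot.liftAlgHom_mkAlgHom_apply K _ _ _).trans (FreeAlgebra.lift_ι_apply _ _)

namespace QuantumTorus

/-- The generator `x i` of the quantum torus as a unit. -/
def xUnit (q : Matrix ι ι Kˣ) (i : ι) : (QuantumTorus q)ˣ where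
  val := x q i
  inv := RingQuot.mkAlgHom K (TorusRel q) (FreeAlgebra.ι K (Sum.inr i))
  val_inv := by
    have h := RingQuot.mkAlgHom_rel K (TorusRel.mul_inv (q := q) i)
    rw [map_mul, map_one] at h
    exact h
  inv_val := by
    have h := RingQuot.mkAlgHom_rel K (TorusRel.inv_mul (q := q) i)
    rw [map_mul, map_one] at h
    exact h

@[simp]
lemma val_xUnit (i : ι) : (xUnit q i : QuantumTorus q) = x q i := rfl

lemma skewCommute_x (i j : ι) : SkewCommute (q i j) (x q i) (x q j) := by
  have h := RingQuot.mkAlgHom_rel K (TorusRel.comm (q := q) i j)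
  rw [map_mul, map_smul, map_mul] at h
  exact h

lemma induction {P : QuantumTorus q → Prop}
    (algebraMap : ∀ r : K, P (algebraMap K _ r)) (x : ∀ i, P (x q i))
    (x_inv : ∀ i, P ((xUnit q i)⁻¹ : (QuantumTorus q)ˣ))
    (add : ∀ a b, P a → P b → P (a + b)) (mul : ∀ a b, P a → P b → P (a * b))
    (a : QuantumTorus q) : P a := by
  obtain ⟨y, rfl⟩ := RingQuot.mkAlgHom_surjective K (TorusRel q) a
  induction y using FreeAlgebra.induction with
  | grade0 r => rw [AlgHom.commutes]; exact algebraMap r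
  | grade1 i => exact i.casesOn x x_inv
  | mul a b ha hb => rw [map_mul]; exact mul _ _ ha hb
  | add a b ha hb => rw [map_add]; exact add _ _ ha hb

lemma ringHom_ext {B : Type*} [Semiring B] {φ ψ : QuantumTorus q →+* B}
    (hK : ∀ r, φ (algebraMap K _ r) = ψ (algebraMap K _ r)) (h : ∀ i, φ (x q i) = ψ (x q i)) :
    φ = ψ := by
  have h_unit (i : ι) : Units.map (φ : QuantumTorus q →* B) (xUnit q i) =
      Units.map (ψ : QuantumTorus q →* B) (xUnit q i) := Units.ext (h i)
  ext a
  induction a using QuantumTorus.induction with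
  | algebraMap r => exact hK r
  | x i => exact h i
  | x_inv i => simpa using congrArg (fun u => ((u⁻¹ : Bˣ) : B)) (h_unit i)
  | add a b ha hb => simp only [map_add, ha, hb]
  | mul a b ha hb => simp only [map_mul, ha, hb]

section Lift

variable {B : Type*} [Ring B] [Algebra K B] {f : ι → Bˣ}
    {hf : ∀ i j, (f i * f j : B) = (q i j : K) • (f j * f i : B)}

@[simp]
lemma lift_x (i : ι) : lift f hf (x q i) = f i :=
  (RingQuot.liftAlgHom_mkAlgHom_apply K _ _ _).trans (FreeAlgebra.lift_ι_apply _ _)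

@[simp]
lemma map_lift_xUnit (i : ι) : Units.map (lift f hf : QuantumTorus q →* B) (xUnit q i) = f i :=
  Units.ext (lift_x i)

lemma algHom_ext {φ ψ : QuantumTorus q →ₐ[K] B} (h : ∀ i, φ (x q i) = ψ (x q i)) : φ = ψ :=
  AlgHom.coe_ringHom_injective (ringHom_ext (fun r => by simp) h)

end Lift

/-- Renumbering the generators of a quantum torus along a bijection. -/
def reindex (q : Matrix ι ι Kˣ) (e : κ ≃ ι) :
    QuantumTorus (q.submatrix e e) ≃ₐ[K] QuantumTorus q :=
  AlgEquiv.ofAlgHom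
    (lift (fun i => xUnit q (e i)) fun i j => (SkewCommute.eq (skewCommute_x (e i) (e j))))
    (lift (fun i => xUnit (q.submatrix e e) (e.symm i)) fun i j => SkewCommute.eq (by
      simpa using skewCommute_x (q := q.submatrix e e) (e.symm i) (e.symm j)))
    (algHom_ext fun i => by simp) (algHom_ext fun i => by simp)

end QuantumTorus

end Generators

section Shear

variable {ι : Type*}

/-- The matrix of commutation scalars of the elements `x k * x p ^ a k`, where `q` is the one of
the units `x k`. -/
def shear {G : Type*} [CommGroup G] (q : Matrix ι ι G) (p : ι) (a : ι → ℤ) : Matrix ι ι G :=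
  fun k l => q k l * q p l ^ a k * q k p ^ a l

lemma shear_neg_shear {G : Type*} [CommGroup G] {q : Matrix ι ι G} {p : ι} (hp : q p p = 1)
    {a : ι → ℤ} (ha : a p = 0) : shear (shear q p a) p (-a) = q := by
  ext k l
  simp [shear, ha, hp, mul_right_comm _ (q k p ^ a l)]

lemma SkewCommute.shear {R B : Type*} [CommRing R] [Ring B] [Algebra R B] {q : Matrix ι ι Rˣ}
    {f : ι → Bˣ} (hf : ∀ i j, SkewCommute (q i j) (f i : B) (f j)) {p : ι} (hp : q p p = 1)
    (a : ι → ℤ) (k l : ι) :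
    SkewCommute (shear q p a k l) ((f k * f p ^ a k : Bˣ) : B) (f l * f p ^ a l : Bˣ) := by
  have hpp : SkewCommute (1 : Rˣ) ((f p ^ a k : Bˣ) : B) ((f p ^ a l : Bˣ) : B) := by
    simpa [hp] using ((hf p p).zpow_left (a k)).zpow_right (a l)
  have h := ((hf k l).mul_right ((hf k p).zpow_right (a l))).mul_left
    (((hf p l).zpow_left (a k)).mul_right hpp)
  simpa [QuantumSpace.shear, mul_right_comm, mul_assoc] using h

end Shear

section ShearEquiv

variable {K : Type u} [Field K] {ι : Type} {q : Matrix ι ι Kˣ}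

lemma MultAntisymm.inv_eq (hq : MultAntisymm q) (i j : ι) : q j i = (q i j)⁻¹ := by
  rcases eq_or_ne i j with rfl | h
  · simp [hq.1]
  · exact hq.2 _ _ h

lemma MultAntisymm.shear (hq : MultAntisymm q) (p : ι) (a : ι → ℤ) :
    MultAntisymm (shear q p a) := by
  constructor
  · intro i
    simp [QuantumSpace.shear, hq.1, hq.inv_eq p i]
  · intro i j _
    simp only [QuantumSpace.shear, hq.inv_eq i j, hq.inv_eq p j, hq.inv_eq i p, mul_inv, inv_zpow,
      mul_right_comm]

/-- The change of generators `x k ↦ x k * x p ^ a k` of a quantum torus. -/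
def QuantumTorus.shearEquiv {p : ι} (hp : q p p = 1) {a : ι → ℤ} (ha : a p = 0) :
    QuantumTorus (shear q p a) ≃ₐ[K] QuantumTorus q :=
  have hp' : QuantumSpace.shear q p a p p = 1 := by simp [QuantumSpace.shear, hp]
  let φ : QuantumTorus (QuantumSpace.shear q p a) →ₐ[K] QuantumTorus q :=
    lift (fun k => xUnit q k * xUnit q p ^ a k) fun k l =>
      (SkewCommute.shear skewCommute_x hp a k l).eq
  let ψ : QuantumTorus q →ₐ[K] QuantumTorus (QuantumSpace.shear q p a) :=
    lift (fun k => xUnit _ k * xUnit _ p ^ (-a) k) fun k l => SkewCommute.eq (by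
      simpa only [shear_neg_shear hp ha] using SkewCommute.shear skewCommute_x hp' (-a) k l)
  have hφψ (i : ι) : Units.map φ.toMonoidHom (Units.map ψ.toMonoidHom (xUnit q i)) = xUnit q i := by
    simp [φ, ψ, ha]
  have hψφ (i : ι) : Units.map ψ.toMonoidHom (Units.map φ.toMonoidHom (xUnit _ i)) = xUnit _ i := by
    simp [φ, ψ, ha]
  AlgEquiv.ofAlgHom φ ψ (algHom_ext fun i => congrArg Units.val (hφψ i))
    (algHom_ext fun i => congrArg Units.val (hψφ i))

end ShearEquiv

section ShearReachable

/-- `q'` is obtained from `q` by finitely many changes of generators `x k ↦ x k * x p ^ a k` with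
`a p = 0`. -/
def ShearReachable {ι G : Type*} [CommGroup G] : Matrix ι ι G → Matrix ι ι G → Prop :=
  Relation.ReflTransGen fun q q' => ∃ p a, a p = 0 ∧ q' = shear q p a

namespace ShearReachable

variable {ι G : Type*} [CommGroup G] {q q' q'' : Matrix ι ι G}

lemma refl (q : Matrix ι ι G) : ShearReachable q q := Relation.ReflTransGen.refl

lemma trans (h : ShearReachable q q') (h' : ShearReachable q' q'') : ShearReachable q q'' :=
  Relation.ReflTransGen.trans h h'

lemma of_shear (q : Matrix ι ι G) {p : ι} {a : ι → ℤ} (ha : a p = 0) :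
    ShearReachable q (shear q p a) :=
  Relation.ReflTransGen.single ⟨p, a, ha, rfl⟩

lemma mem (h : ShearReachable q q') {H : Subgroup G} (hq : ∀ k l, q k l ∈ H) (k l : ι) :
    q' k l ∈ H := by
  induction h generalizing k l with
  | refl => exact hq k l
  | tail _ h ih =>
    obtain ⟨p, a, -, rfl⟩ := h
    exact mul_mem (mul_mem (ih _ _) (zpow_mem (ih _ _) _)) (zpow_mem (ih _ _) _)

lemma extend {P : ι → Prop} (hP : ∀ k l, P k → ¬ P l → q k l = 1 ∧ q l k = 1)
    {r : Matrix {k // P k} {k // P k} G} (h : ShearReachable (q.submatrix (↑) (↑)) r) :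
    ∃ q', ShearReachable q q' ∧ q'.submatrix (↑) (↑) = r ∧
      (∀ k l, P k → ¬ P l → q' k l = 1 ∧ q' l k = 1) ∧
      ∀ k l, ¬ P k → ¬ P l → q' k l = q k l := by
  classical
  induction h with
  | refl => exact ⟨q, .refl q, rfl, hP, fun _ _ _ _ => rfl⟩
  | tail _ h ih =>
    obtain ⟨p, a, ha, rfl⟩ := h
    obtain ⟨q', hr, rfl, h_off, h_compl⟩ := ih
    let b (k : ι) : ℤ := if hk : P k then a ⟨k, hk⟩ else 0
    have hb (k : {k // P k}) : b k = a k := dif_pos k.2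
    have hb' (k : ι) (hk : ¬ P k) : b k = 0 := dif_neg hk
    refine ⟨shear q' p b, hr.trans (of_shear q' ((hb p).trans ha)), ?_, fun k l hk hl => ?_,
      fun k l hk hl => ?_⟩
    · ext k l
      simp [shear, hb]
    · simp [shear, h_off k l hk hl, h_off p l p.2 hl, hb' l hl]
    · simp [shear, h_compl k l hk hl, hb' l hl, hb' k hk]

end ShearReachable

variable {K : Type u} [Field K]

lemma ShearReachable.multAntisymm {ι : Type} {q q' : Matrix ι ι Kˣ} (h : ShearReachable q q')
    (hq : MultAntisymm q) : MultAntisymm q' := by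
  induction h with
  | refl => exact hq
  | tail _ h ih =>
    obtain ⟨p, a, -, rfl⟩ := h
    exact ih.shear p a

lemma ShearReachable.symm {ι : Type} {q q' : Matrix ι ι Kˣ} (h : ShearReachable q q')
    (hq : MultAntisymm q) : ShearReachable q' q := by
  induction h with
  | refl => exact .refl q
  | @tail r _ h h' ih =>
    obtain ⟨p, a, ha, rfl⟩ := h'
    have hp : r p p = 1 := (ShearReachable.multAntisymm h hq).1 p
    refine .trans ?_ ih
    simpa only [shear_neg_shear hp ha] using
      ShearReachable.of_shear (shear r p a) (p := p) (a := -a) (by simp [ha])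

lemma ShearReachable.nonempty_algEquiv {ι : Type} {q q' : Matrix ι ι Kˣ}
    (h : ShearReachable q q') (hq : MultAntisymm q) :
    Nonempty (QuantumTorus q' ≃ₐ[K] QuantumTorus q) := by
  induction h with
  | refl => exact ⟨AlgEquiv.refl⟩
  | tail h h' ih =>
    obtain ⟨p, a, ha, rfl⟩ := h'
    obtain ⟨f⟩ := ih
    have hp := (ShearReachable.multAntisymm h hq).1 p
    exact ⟨(QuantumTorus.shearEquiv hp ha).trans f⟩

end ShearReachable

section MinimalExponent

variable {K : Type u} [Field K] {ι : Type} {ζ : Kˣ} {q : Matrix ι ι Kˣ} {h : ℕ} {i j k : ι}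

/-- No matrix reachable from `q` has a nontrivial entry `ζ ^ b` with `b < h`. -/
def MinimalExponent (ζ : Kˣ) (q : Matrix ι ι Kˣ) (h : ℕ) : Prop :=
  ∀ q', ShearReachable q q' → ∀ k l, ∀ b < h, q' k l = ζ ^ b → q' k l = 1

lemma exists_minimalExponent (hm : 0 < orderOf ζ) (hz : ∀ k l, q k l ∈ Subgroup.zpowers ζ)
    (hne : ∃ k l, q k l ≠ 1) :
    ∃ h q' i j, ShearReachable q q' ∧ q' i j = ζ ^ h ∧ ζ ^ h ≠ 1 ∧ MinimalExponent ζ q' h := by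
  classical
  have hex : ∃ h : ℕ, ∃ q' i j, ShearReachable q q' ∧ q' i j = ζ ^ h ∧ ζ ^ h ≠ 1 := by
    obtain ⟨k, l, hkl⟩ := hne
    obtain ⟨b, hb⟩ := (isOfFinOrder_iff_pow_eq_one.2
      ⟨_, hm, pow_orderOf_eq_one ζ⟩).mem_powers_iff_mem_zpowers.2 (hz k l)
    exact ⟨b, q, k, l, .refl q, hb.symm, hb.trans_ne hkl⟩
  obtain ⟨q', i, j, hr, hij, h_ne⟩ := Nat.find_spec hex
  refine ⟨Nat.find hex, q', i, j, hr, hij, h_ne, fun r hr' k l b hb hkl => ?_⟩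
  by_contra hkl'
  exact Nat.find_min hex hb ⟨r, k, l, hr.trans hr', hkl, hkl ▸ hkl'⟩

namespace MinimalExponent

lemma of_reachable (hmin : MinimalExponent ζ q h) {q' : Matrix ι ι Kˣ}
    (hr : ShearReachable q q') : MinimalExponent ζ q' h :=
  fun _ hr' => hmin _ (hr.trans hr')

/-- Division with remainder: some `g * (ζ ^ h) ^ a` is a power of `ζ` with exponent less than
`h`. -/
lemma mem_zpowers (hmin : MinimalExponent ζ q h) (hh : 0 < h) {g : Kˣ}
    (hg : g ∈ Subgroup.zpowers ζ)
    (hr : ∀ a : ℤ, ∃ q', ShearReachable q q' ∧ ∃ k l, q' k l = g * (ζ ^ h) ^ a) :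
    g ∈ Subgroup.zpowers (ζ ^ h) := by
  obtain ⟨b, rfl⟩ := Subgroup.mem_zpowers_iff.1 hg
  obtain ⟨r, hr_eq⟩ := Int.eq_ofNat_of_zero_le (Int.emod_nonneg b (b := h) (by positivity))
  have hlt : r < h := by
    have := Int.emod_lt_of_pos b (b := h) (by positivity)
    omega
  have hb : ζ ^ b * (ζ ^ h) ^ (-(b / h)) = ζ ^ r := by
    rw [← zpow_natCast ζ h, ← zpow_mul, ← zpow_add, ← zpow_natCast ζ r, ← hr_eq, Int.emod_def]
    congr 1
    ring
  obtain ⟨q', hq', k, l, hkl⟩ := hr (-(b / h))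
  have h_one : ζ ^ b * (ζ ^ h) ^ (-(b / h)) = 1 :=
    hkl.symm.trans (hmin q' hq' k l r hlt (hkl.trans hb))
  rw [zpow_neg, mul_inv_eq_one] at h_one
  exact ⟨b / h, h_one.symm⟩

lemma reachable_row (hij : q i j = ζ ^ h) (hki : k ≠ i) (hkj : k ≠ j) (a : ℤ) :
    ∃ q', ShearReachable q q' ∧ q' k j = q k j * (ζ ^ h) ^ a := by
  classical
  exact ⟨shear q i (Pi.single k a), .of_shear q (Pi.single_eq_of_ne hki.symm _),
    by simp [shear, hij, hkj.symm]⟩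

lemma reachable_column (hij : q i j = ζ ^ h) (hki : k ≠ i) (hkj : k ≠ j) (a : ℤ) :
    ∃ q', ShearReachable q q' ∧ q' i k = q i k * (ζ ^ h) ^ a := by
  classical
  exact ⟨shear q j (Pi.single k a), .of_shear q (Pi.single_eq_of_ne hkj.symm _),
    by simp [shear, hij, hki.symm]⟩

variable (hmin : MinimalExponent ζ q h) (hh : 0 < h) (hz : ∀ k l, q k l ∈ Subgroup.zpowers ζ)
  (hij : q i j = ζ ^ h)

include hmin hh hz hij

lemma row_mem_zpowers (hki : k ≠ i) (hkj : k ≠ j) : q k j ∈ Subgroup.zpowers (ζ ^ h) :=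
  hmin.mem_zpowers hh (hz k j) fun a =>
    have ⟨q', hr, hq'⟩ := reachable_row hij hki hkj a
    ⟨q', hr, k, j, hq'⟩

lemma column_mem_zpowers (hki : k ≠ i) (hkj : k ≠ j) : q i k ∈ Subgroup.zpowers (ζ ^ h) :=
  hmin.mem_zpowers hh (hz i k) fun a =>
    have ⟨q', hr, hq'⟩ := reachable_column hij hki hkj a
    ⟨q', hr, i, k, hq'⟩

lemma dvd_orderOf (hne : ζ ^ h ≠ 1) (hki : k ≠ i) (hkj : k ≠ j) : h ∣ orderOf ζ := by
  set g := Nat.gcd h (orderOf ζ)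
  suffices g = h from this ▸ Nat.gcd_dvd_right h (orderOf ζ)
  by_contra hgh
  have hlt : g < h := lt_of_le_of_ne (Nat.gcd_le_left _ hh) hgh
  obtain ⟨a, ha : (ζ ^ h) ^ a = q k j⟩ := hmin.row_mem_zpowers hh hz hij hki hkj
  obtain ⟨q', hr, hq'⟩ := reachable_row hij hki hkj (-a + Nat.gcdA h (orderOf ζ))
  have h_gcd : (ζ ^ h) ^ Nat.gcdA h (orderOf ζ) = ζ ^ g := by
    rw [← zpow_natCast ζ g, Nat.gcd_eq_gcd_ab, zpow_add, zpow_mul, zpow_mul]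
    simp [pow_orderOf_eq_one]
  rw [zpow_add, ← mul_assoc, ← ha, zpow_neg, mul_inv_cancel, one_mul, h_gcd] at hq'
  have h_one : ζ ^ g = 1 := hq'.symm.trans (hmin q' hr k j g hlt hq')
  exact hne (orderOf_dvd_iff_pow_eq_one.1
    ((orderOf_dvd_of_pow_eq_one h_one).trans (Nat.gcd_dvd_left _ _)))

end MinimalExponent

lemma exists_shear_clearing {ι G : Type*} [CommGroup G] {q : Matrix ι ι G} {p l : ι}
    (hmem : ∀ k, k ≠ p → k ≠ l → q k l ∈ Subgroup.zpowers (q p l)) :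
    ∃ a : ι → ℤ, a p = 0 ∧ a l = 0 ∧ ∀ k, k ≠ p → k ≠ l → shear q p a k l = 1 := by
  have hex (k : ι) : ∃ a : ℤ, (k = p ∨ k = l → a = 0) ∧
      (k ≠ p → k ≠ l → q k l * q p l ^ a = 1) := by
    by_cases hk : k = p ∨ k = l
    · exact ⟨0, fun _ => rfl, by tauto⟩
    · obtain ⟨a, ha : q p l ^ a = q k l⟩ := hmem k (by tauto) (by tauto)
      exact ⟨-a, by tauto, fun _ _ => by rw [zpow_neg, ha, mul_inv_cancel]⟩
  choose a ha₀ ha using hex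
  exact ⟨a, ha₀ p (.inl rfl), ha₀ l (.inr rfl), fun k hkp hkl => by
    simpa [shear, ha₀ l] using ha k hkp hkl⟩

namespace MinimalExponent

variable (hmin : MinimalExponent ζ q h) (hh : 0 < h) (hz : ∀ k l, q k l ∈ Subgroup.zpowers ζ)
  (hq : MultAntisymm q) (hij : q i j = ζ ^ h)

include hmin hh hz hq hij

lemma exists_reachable_decoupled :
    ∃ r, ShearReachable q r ∧ r i j = ζ ^ h ∧ ∀ k, k ≠ i → k ≠ j → r k i = 1 ∧ r k j = 1 := by
  obtain ⟨a, ha_i, ha_j, hcol_j⟩ := exists_shear_clearing (q := q) (p := i) (l := j)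
    fun k hki hkj => hij ▸ hmin.row_mem_zpowers hh hz hij hki hkj
  have hr₁ : ShearReachable q (shear q i a) := .of_shear q ha_i
  have hij₁ : shear q i a i j = ζ ^ h := by simp [shear, ha_i, ha_j, hij]
  generalize shear q i a = r₁ at hr₁ hij₁ hcol_j
  have hanti := hr₁.multAntisymm hq
  obtain ⟨b, hb_j, hb_i, hcol_i⟩ := exists_shear_clearing (q := r₁) (p := j) (l := i)
    fun k hkj hki => by
      rw [hanti.inv_eq i k, hanti.inv_eq i j, hij₁, Subgroup.zpowers_inv]
      exact inv_mem ((hmin.of_reachable hr₁).column_mem_zpowers hh (hr₁.mem hz) hij₁ hki hkj)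
  refine ⟨shear r₁ j b, hr₁.trans (.of_shear r₁ hb_j), ?_, fun k hki hkj =>
    ⟨hcol_i k hkj hki, ?_⟩⟩
  · simp [shear, hb_i, hb_j, hij₁]
  · simp [shear, hb_j, hcol_j k hki hkj, hanti.1]

/-- After the shear `x i ↦ x i * x k`, the entry at `(k, l)` appears at `(i, l)`. -/
lemma mem_zpowers_of_decoupled (hne : i ≠ j) (hdec : ∀ k, k ≠ i → k ≠ j → q k i = 1 ∧ q k j = 1)
    {l : ι} (hki : k ≠ i) (hkj : k ≠ j) (hli : l ≠ i) (hlj : l ≠ j) :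
    q k l ∈ Subgroup.zpowers (ζ ^ h) := by
  classical
  have hr : ShearReachable q (shear q k (Pi.single i 1)) := .of_shear q (by simp [hki])
  have hil : shear q k (Pi.single i 1) i l = q k l := by
    simp [shear, hq.inv_eq l i, hdec l hli hlj, hli]
  have hij_shear : shear q k (Pi.single i 1) i j = ζ ^ h := by
    simp [shear, hij, hdec k hki hkj, hne.symm]
  exact hil ▸ (hmin.of_reachable hr).column_mem_zpowers hh (hr.mem hz) hij_shear hli hlj

end MinimalExponent

end MinimalExponent

section BlockIndex

variable {K : Type u} [Field K] {ι : Type} {s t : ℕ}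

lemma blockMatrix_mem {c : Fin s → Kˣ} {H : Subgroup Kˣ} (hc : ∀ i, c i ∈ H)
    (x y : BlockIndex s t) : blockMatrix c x y ∈ H := by
  rcases x with i | i | i <;> rcases y with j | j | j <;> simp only [blockMatrix]
  any_goals exact one_mem H
  · split_ifs
    exacts [hc i, one_mem H]
  · split_ifs
    exacts [inv_mem (hc i), one_mem H]

namespace BlockIndex

/-- The numbering of the generators in which `i` and `j` form a new first factor of rank two. -/
def cons (i j : ι) (f : BlockIndex s t → ι) : BlockIndex (s + 1) t → ι :=
  Sum.elim (Fin.cases i fun x => f (.inl x))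
    (Sum.elim (Fin.cases j fun x => f (.inr (.inl x))) fun x => f (.inr (.inr x)))

lemma bijective_cons {i j : ι} (hij : i ≠ j) (e : BlockIndex s t ≃ {k // k ≠ i ∧ k ≠ j}) :
    Function.Bijective (cons i j fun x => (e x : ι)) := by
  have hi (x) : (e x : ι) ≠ i := (e x).2.1
  have hj (x) : (e x : ι) ≠ j := (e x).2.2
  constructor
  · rintro (x | x | x) (y | y | y) <;> try cases x using Fin.cases
    all_goals try cases y using Fin.cases
    all_goals simp [cons, hi, hj, (hi _).symm, (hj _).symm, hij, hij.symm, Subtype.val_inj]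
  · intro k
    by_cases hk : k ≠ i ∧ k ≠ j
    · obtain ⟨x | x | x, hx⟩ := e.surjective ⟨k, hk⟩
      · exact ⟨.inl x.succ, congrArg Subtype.val hx⟩
      · exact ⟨.inr (.inl x.succ), congrArg Subtype.val hx⟩
      · exact ⟨.inr (.inr x), congrArg Subtype.val hx⟩
    · obtain rfl | rfl : k = i ∨ k = j := by tauto
      · exact ⟨.inl 0, rfl⟩
      · exact ⟨.inr (.inl 0), rfl⟩

lemma submatrix_cons {q : Matrix ι ι Kˣ} (hq : MultAntisymm q) {i j : ι}
    {f : BlockIndex s t → ι} {c : Fin s → Kˣ} (hf : q.submatrix f f = blockMatrix c)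
    (hi : ∀ x, q (f x) i = 1) (hj : ∀ x, q (f x) j = 1) :
    q.submatrix (cons i j f) (cons i j f) = blockMatrix (Fin.cons (q i j) c) := by
  have hf' (x y) : q (f x) (f y) = blockMatrix c x y := congrFun (congrFun hf x) y
  have hi' (x) : q i (f x) = 1 := by rw [hq.inv_eq (f x), hi, inv_one]
  have hj' (x) : q j (f x) = 1 := by rw [hq.inv_eq (f x), hj, inv_one]
  have hji : q j i = (q i j)⁻¹ := hq.inv_eq i j
  ext1 (x | x | x) (y | y | y) <;> try cases x using Fin.cases
  all_goals try cases y using Fin.cases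
  all_goals simp [cons, blockMatrix, hi, hj, hi', hj', hji, hf', hq.1, Fin.succ_ne_zero,
    (Fin.succ_ne_zero _).symm]

end BlockIndex

end BlockIndex

section BlockReduction

variable {K : Type u} [Field K] {ι : Type} {ζ : Kˣ} {d s t : ℕ}

/-- The conditions on the exponents of a normal form with `s` factors of rank two and `t` central
variables, where moreover all exponents are multiples of `d`. -/
structure AdmissibleExponents (ζ : Kˣ) (d t : ℕ) (h : Fin s → ℕ) (z : ℕ) : Prop where
  h_dvd_order : ∀ i, h i ∣ orderOf ζ
  h_ne_zero : ∀ i, ¬ orderOf ζ ∣ h i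
  h_dvd : ∀ i j, i ≤ j → h i ∣ h j
  dvd_h : ∀ i, d ∣ h i
  z_pos : 0 < z
  z_eq_one : 0 < t → z = 1
  z_order : ∀ i : Fin s, i.val + 1 = s → orderOf (ζ ^ (z * h i)) = orderOf (ζ ^ h i)

namespace AdmissibleExponents

lemma nil (ζ : Kˣ) (d t : ℕ) : AdmissibleExponents ζ d t Fin.elim0 1 where
  h_dvd_order i := i.elim0
  h_ne_zero i := i.elim0
  h_dvd i := i.elim0
  dvd_h i := i.elim0
  z_pos := one_pos
  z_eq_one _ := rfl
  z_order i := i.elim0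

lemma single {e : ℕ} (hd : d ∣ orderOf ζ) (hde : d ∣ e) (he : ζ ^ e ≠ 1) :
    AdmissibleExponents ζ d 0 (fun _ : Fin 1 => e.gcd (orderOf ζ)) (e / e.gcd (orderOf ζ)) where
  h_dvd_order _ := Nat.gcd_dvd_right _ _
  h_ne_zero _ h := he (orderOf_dvd_iff_pow_eq_one.1 (h.trans (Nat.gcd_dvd_left _ _)))
  h_dvd _ _ _ := dvd_rfl
  dvd_h _ := Nat.dvd_gcd hde hd
  z_pos := by
    have hpos : 0 < e := Nat.pos_of_ne_zero fun h => he (by rw [h, pow_zero])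
    exact Nat.div_pos (Nat.gcd_le_left _ hpos) (Nat.gcd_pos_of_pos_left _ hpos)
  z_eq_one h := absurd h (lt_irrefl _)
  z_order _ _ := by
    have hpos : 0 < e := Nat.pos_of_ne_zero fun h => he (by rw [h, pow_zero])
    rw [Nat.div_mul_cancel (Nat.gcd_dvd_left _ _), orderOf_pow' ζ hpos.ne',
      orderOf_pow' ζ (Nat.gcd_pos_of_pos_left _ hpos).ne',
      Nat.gcd_eq_right (Nat.gcd_dvd_right _ _), Nat.gcd_comm]

lemma cons {e z : ℕ} {h : Fin s → ℕ} (H : AdmissibleExponents ζ e t h z) (he : e ∣ orderOf ζ)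
    (hde : d ∣ e) (hne : ζ ^ e ≠ 1) (hz : s = 0 → z = 1) :
    AdmissibleExponents ζ d t (Fin.cons e h : Fin (s + 1) → ℕ) z where
  h_dvd_order := Fin.cases he H.h_dvd_order
  h_ne_zero := Fin.cases (fun h' => hne (orderOf_dvd_iff_pow_eq_one.1 h')) H.h_ne_zero
  h_dvd x y hxy := by
    cases x using Fin.cases with
    | zero => exact y.cases dvd_rfl H.dvd_h
    | succ x => cases y using Fin.cases with
      | zero => simp at hxy
      | succ y => exact H.h_dvd x y (Fin.succ_le_succ_iff.1 hxy)
  dvd_h := Fin.cases hde fun x => hde.trans (H.dvd_h x)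
  z_pos := H.z_pos
  z_eq_one := H.z_eq_one
  z_order x hx := by
    cases x using Fin.cases with
    | zero => simp [hz (by simpa using hx.symm)]
    | succ x => simpa using H.z_order x (by simpa using hx)

lemma dvd_exponent {h : Fin s → ℕ} {z : ℕ} (H : AdmissibleExponents ζ d t h z) {i j : Fin s}
    (hij : i ≤ j) : h i ∣ exponent h z j := by
  unfold exponent
  split_ifs
  exacts [(H.h_dvd i j hij).mul_left z, H.h_dvd i j hij]

end AdmissibleExponents

lemma pow_exponent_cons {e z : ℕ} {h : Fin s → ℕ} (hz : s = 0 → z = 1) :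
    (fun i => ζ ^ exponent (Fin.cons e h : Fin (s + 1) → ℕ) z i) =
      Fin.cons (ζ ^ e) fun i => ζ ^ exponent h z i := by
  refine funext (Fin.cases ?_ fun i => ?_)
  · by_cases hs : s = 0 <;> simp [exponent, hs, hz, eq_comm]
  · simp [exponent]

/-- Some matrix reachable from `q` is, up to renumbering, the parameter matrix of a tensor product
of quantum tori of rank two and a group algebra, with exponents as in a normal form that are
multiples of `d`. -/
def HasBlockReduction (ζ : Kˣ) (d : ℕ) (q : Matrix ι ι Kˣ) : Prop :=
  ∃ (s t : ℕ) (h : Fin s → ℕ) (z : ℕ) (e : BlockIndex s t ≃ ι) (q' : Matrix ι ι Kˣ),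
    ShearReachable q q' ∧ q'.submatrix e e = blockMatrix (fun i => ζ ^ exponent h z i) ∧
      AdmissibleExponents ζ d t h z

namespace HasBlockReduction

variable {q : Matrix ι ι Kˣ}

lemma of_reachable {q' : Matrix ι ι Kˣ} (hr : ShearReachable q q')
    (hq' : HasBlockReduction ζ d q') : HasBlockReduction ζ d q := by
  obtain ⟨s, t, h, z, e, r, hr', H⟩ := hq'
  exact ⟨s, t, h, z, e, r, hr.trans hr', H⟩

lemma of_eq_one [Finite ι] (hq : ∀ k l, q k l = 1) : HasBlockReduction ζ d q := by
  let e : BlockIndex 0 (Nat.card ι) ≃ ι :=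
    (Equiv.emptySum _ _).trans ((Equiv.emptySum _ _).trans (Finite.equivFin ι).symm)
  refine ⟨0, Nat.card ι, Fin.elim0, 1, e, q, .refl q, ?_, .nil ζ d _⟩
  ext1 (x | x | x) (y | y | y)
  exacts [x.elim0, x.elim0, x.elim0, x.elim0, x.elim0, x.elim0, y.elim0, y.elim0, hq _ _]

lemma of_forall_eq_or_eq (hd : d ∣ orderOf ζ) (hq : MultAntisymm q) {i j : ι} (hij : i ≠ j)
    {e : ℕ} (hde : d ∣ e) (hqij : q i j = ζ ^ e) (hne : ζ ^ e ≠ 1)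
    (htwo : ∀ k, k = i ∨ k = j) : HasBlockReduction ζ d q := by
  have : IsEmpty {k // k ≠ i ∧ k ≠ j} := ⟨fun k => (htwo k).elim k.2.1 k.2.2⟩
  let f : BlockIndex 0 0 ≃ {k // k ≠ i ∧ k ≠ j} := Equiv.equivOfIsEmpty _ _
  refine ⟨1, 0, fun _ => e.gcd (orderOf ζ), e / e.gcd (orderOf ζ),
    .ofBijective _ (BlockIndex.bijective_cons hij f), q, .refl q, ?_, .single hd hde hne⟩
  have hc : (fun i => ζ ^ exponent (fun _ : Fin 1 => e.gcd (orderOf ζ))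
      (e / e.gcd (orderOf ζ)) i) = Fin.cons (q i j) (Fin.elim0 : Fin 0 → Kˣ) := by
    ext x
    simp [Subsingleton.elim x 0, exponent, hqij, Nat.div_mul_cancel (Nat.gcd_dvd_left _ _)]
  rw [hc]
  exact BlockIndex.submatrix_cons (f := fun x => (f x : ι)) hq (Subsingleton.elim _ _) isEmptyElim
    isEmptyElim

lemma of_decoupled (hq : MultAntisymm q) {e : ℕ} {i j k : ι} (hij : i ≠ j)
    (hqij : q i j = ζ ^ e) (hne : ζ ^ e ≠ 1) (he : e ∣ orderOf ζ) (hde : d ∣ e)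
    (hdec : ∀ k, k ≠ i → k ≠ j → q k i = 1 ∧ q k j = 1) (hki : k ≠ i) (hkj : k ≠ j)
    (hrest : HasBlockReduction ζ e
      (q.submatrix (Subtype.val : {k // k ≠ i ∧ k ≠ j} → ι) Subtype.val)) :
    HasBlockReduction ζ d q := by
  obtain ⟨s, t, h, z, f, r, hr, hrf, H⟩ := hrest
  obtain ⟨q', hr', rfl, h_off, h_compl⟩ := hr.extend fun k l hk hl => by
    obtain rfl | rfl : l = i ∨ l = j := by tauto
    · simp [hdec k hk.1 hk.2, hq.inv_eq k l]
    · simp [hdec k hk.1 hk.2, hq.inv_eq k l]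
  have hz (hs : s = 0) : z = 1 := H.z_eq_one <| by
    subst hs
    obtain x | x | x := f.symm ⟨k, hki, hkj⟩
    exacts [x.elim0, x.elim0, x.pos]
  refine ⟨s + 1, t, Fin.cons e h, z, .ofBijective _ (BlockIndex.bijective_cons hij f), q', hr', ?_,
    H.cons he hde hne hz⟩
  have hq'ij : q' i j = ζ ^ e := by rw [h_compl i j (by simp) (by simp), hqij]
  rw [pow_exponent_cons hz, ← hq'ij]
  exact BlockIndex.submatrix_cons (hr'.multAntisymm hq) hrf
    (fun x => (h_off _ i (f x).2 (by simp)).1) (fun x => (h_off _ j (f x).2 (by simp)).1)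

end HasBlockReduction

lemma dvd_of_pow_mem_zpowers {G : Type*} [Group G] {g : G} {d b : ℕ} (hd : d ∣ orderOf g)
    (h : g ^ b ∈ Subgroup.zpowers (g ^ d)) : d ∣ b := by
  obtain ⟨z, hz⟩ := Subgroup.mem_zpowers_iff.1 h
  have h_one : g ^ (d * z - b : ℤ) = 1 := by
    rw [zpow_sub, zpow_mul, zpow_natCast, zpow_natCast, hz, mul_inv_cancel]
  have hdvd := (Int.natCast_dvd_natCast.2 hd).trans (orderOf_dvd_iff_zpow_eq_one.2 h_one)
  rw [dvd_sub_right (dvd_mul_right _ _)] at hdvd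
  exact_mod_cast hdvd

theorem hasBlockReduction [Finite ι] (hm : 0 < orderOf ζ) (hd : d ∣ orderOf ζ)
    {q : Matrix ι ι Kˣ} (hq : MultAntisymm q) (hz : ∀ k l, q k l ∈ Subgroup.zpowers (ζ ^ d)) :
    HasBlockReduction ζ d q := by
  induction hN : Nat.card ι using Nat.strong_induction_on generalizing ι d with
  | _ N ih =>
  by_cases h_triv : ∀ k l, q k l = 1
  · exact .of_eq_one h_triv
  have hle : Subgroup.zpowers (ζ ^ d) ≤ Subgroup.zpowers ζ :=
    Subgroup.zpowers_le.2 (Subgroup.npow_mem_zpowers ζ d)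
  obtain ⟨h, q', i, j, hr, hij, hne, hmin⟩ :=
    exists_minimalExponent hm (fun k l => hle (hz k l)) (by push Not at h_triv; exact h_triv)
  refine .of_reachable hr ?_
  replace hz := hr.mem hz
  replace hq := hr.multAntisymm hq
  have hdh : d ∣ h := dvd_of_pow_mem_zpowers hd (hij ▸ hz i j)
  have h_pos : 0 < h := Nat.pos_of_ne_zero fun h0 => hne (by rw [h0, pow_zero])
  have hij_ne : i ≠ j := by
    rintro rfl
    exact hne (hij.symm.trans (hq.1 i))
  by_cases h_two : ∀ k, k = i ∨ k = j
  · exact .of_forall_eq_or_eq hd hq hij_ne hdh hij hne h_two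
  obtain ⟨k, hki, hkj⟩ : ∃ k, k ≠ i ∧ k ≠ j := by simpa using h_two
  have hdvd := hmin.dvd_orderOf h_pos (fun k l => hle (hz k l)) hij hne hki hkj
  obtain ⟨r, hr, hr_ij, hdec⟩ :=
    hmin.exists_reachable_decoupled h_pos (fun k l => hle (hz k l)) hq hij
  refine .of_reachable hr (.of_decoupled (hr.multAntisymm hq) hij_ne hr_ij hne hdvd hdh hdec hki
    hkj ?_)
  refine ih (Nat.card {k // k ≠ i ∧ k ≠ j}) (hN ▸ Finite.card_subtype_lt (x := i) (by simp)) hdvd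
    ⟨fun _ => (hr.multAntisymm hq).1 _, fun _ _ _ => (hr.multAntisymm hq).inv_eq _ _⟩
    (fun k l => ?_) rfl
  exact (hmin.of_reachable hr).mem_zpowers_of_decoupled h_pos
    (hr.mem fun k l => hle (hz k l)) (hr.multAntisymm hq) hr_ij hij_ne hdec k.2.1 k.2.2 l.2.1 l.2.2

lemma AdmissibleExponents.h_first {n : ℕ} {q : Matrix (Fin n) (Fin n) Kˣ} (hq : MultAntisymm q)
    (hζ : Subgroup.zpowers ζ = paramGroup q) {h : Fin s → ℕ} {z : ℕ}
    (H : AdmissibleExponents ζ d t h z) {q' : Matrix (Fin n) (Fin n) Kˣ}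
    (hr : ShearReachable q q') {e : BlockIndex s t ≃ Fin n}
    (he : q'.submatrix e e = blockMatrix (fun i => ζ ^ exponent h z i)) {i : Fin s}
    (hi : i.val = 0) : h i = 1 := by
  have h_exponent (j : Fin s) : ζ ^ exponent h z j ∈ Subgroup.zpowers (ζ ^ h i) := by
    obtain ⟨c, hc⟩ := H.dvd_exponent (Fin.le_def.2 (hi.trans_le j.val.zero_le))
    rw [hc, pow_mul]
    exact Subgroup.npow_mem_zpowers _ c
  have hq' (k l) : q' k l ∈ Subgroup.zpowers (ζ ^ h i) := by
    simpa [← he] using blockMatrix_mem h_exponent (e.symm k) (e.symm l)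
  have hle : paramGroup q ≤ Subgroup.zpowers (ζ ^ h i) := by
    rw [paramGroup, Subgroup.closure_le]
    rintro _ ⟨p, rfl⟩
    exact (hr.symm hq).mem hq' _ _
  refine Nat.dvd_one.1 (dvd_of_pow_mem_zpowers (H.h_dvd_order i) ?_)
  rw [pow_one]
  exact hle (hζ ▸ Subgroup.mem_zpowers ζ)

theorem nonempty_normalForm {n : ℕ} {q : Matrix (Fin n) (Fin n) Kˣ} (hq : MultAntisymm q)
    (hm : 0 < orderOf ζ) (hζ : Subgroup.zpowers ζ = paramGroup q) :
    Nonempty (NormalForm q ζ) := by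
  obtain ⟨s, t, h, z, e, q', hr, he, H⟩ := hasBlockReduction hm (one_dvd _) hq fun k l => by
    rw [pow_one, hζ]
    exact Subgroup.subset_closure ⟨(k, l), rfl⟩
  have hcard : s + (s + t) = n := by simpa using Fintype.card_congr e
  obtain rfl : t = n - 2 * s := by omega
  obtain ⟨f⟩ := hr.nonempty_algEquiv hq
  exact ⟨{
    s := s
    two_mul_le := by omega
    h := h
    h_dvd_order := H.h_dvd_order
    h_first := fun i hi => H.h_first hq hζ hr he hi
    h_ne_zero := fun i _ => H.h_ne_zero i
    h_dvd := H.h_dvd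
    z := z
    z_pos := H.z_pos
    z_eq_one := fun hn => H.z_eq_one (by omega)
    z_order := H.z_order
    iso := (he ▸ QuantumTorus.reindex q' e).trans f }⟩

end BlockReduction

section NormalElement

/-- An element `x` of a ring `R` is normal if `x R = R x`. -/
def IsNormalElement {R : Type*} [Ring R] (x : R) : Prop :=
  ∀ a, (∃ b, x * a = b * x) ∧ ∃ b, a * x = x * b

lemma IsNormalElement.op {R : Type*} [Ring R] {x : R} (h : IsNormalElement x) :
    IsNormalElement (MulOpposite.op x) := by
  intro a
  obtain ⟨⟨b, hb⟩, c, hc⟩ := h a.unop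
  exact ⟨⟨.op c, unop_injective hc⟩, .op b, unop_injective hb⟩

lemma IsNormalElement.bijective_smul {R N : Type*} [Ring R] [AddCommGroup N] [Module R N]
    [IsSimpleModule R N] {x : R} (hx : IsNormalElement x) (h : ∃ v : N, x • v ≠ 0) :
    Function.Bijective fun v : N => x • v := by
  obtain ⟨v₀, hv₀⟩ := h
  let f : N →+ N := DistribSMul.toAddMonoidHom N x
  let ker : Submodule R N :=
    { f.ker with
      smul_mem' := fun a v (hv : x • v = 0) => by
        obtain ⟨b, hb⟩ := (hx a).1
        change x • a • v = 0
        rw [smul_smul, hb, mul_smul, hv, smul_zero] }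
  let range : Submodule R N :=
    { f.range with
      smul_mem' := by
        rintro a _ ⟨v, rfl⟩
        obtain ⟨b, hb⟩ := (hx a).2
        refine ⟨b • v, ?_⟩
        change x • b • v = a • x • v
        rw [smul_smul, ← hb, mul_smul] }
  have h_ker : ker = ⊥ := (eq_bot_or_eq_top ker).resolve_right fun h =>
    hv₀ (h.ge Submodule.mem_top : v₀ ∈ ker)
  have h_range : range = ⊤ := (eq_bot_or_eq_top range).resolve_left fun h =>
    hv₀ ((Submodule.mem_bot R).1 (h.le (⟨v₀, rfl⟩ : x • v₀ ∈ range)))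
  exact ⟨(injective_iff_map_eq_zero f).2 fun v hv => (Submodule.mem_bot R).1 (h_ker.le hv),
    fun v => h_range.ge (Submodule.mem_top : v ∈ _)⟩

end NormalElement

section Extension

variable {K : Type u} [Field K]

lemma QuantumAffine.isNormalElement_x {ι : Type} (q : Matrix ι ι Kˣ) (i : ι) :
    IsNormalElement (x q i) := by
  intro a
  induction a using QuantumAffine.induction with
  | algebraMap r => exact ⟨⟨_, (Algebra.commutes r _).symm⟩, ⟨_, Algebra.commutes r _⟩⟩
  | x j =>
    refine ⟨⟨(q i j : K) • x q j, ?_⟩, ⟨(q j i : K) • x q j, ?_⟩⟩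
    · rw [(skewCommute_x i j).eq, smul_mul_assoc]
    · rw [(skewCommute_x j i).eq, mul_smul_comm]
  | add a b ha hb =>
    obtain ⟨⟨a₁, h₁⟩, a₂, h₂⟩ := ha
    obtain ⟨⟨b₁, h₃⟩, b₂, h₄⟩ := hb
    exact ⟨⟨a₁ + b₁, by rw [mul_add, add_mul, h₁, h₃]⟩, a₂ + b₂, by rw [mul_add, add_mul, h₂, h₄]⟩
  | mul a b ha hb =>
    obtain ⟨⟨a₁, h₁⟩, a₂, h₂⟩ := ha
    obtain ⟨⟨b₁, h₃⟩, b₂, h₄⟩ := hb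
    exact ⟨⟨a₁ * b₁, by rw [← mul_assoc, h₁, mul_assoc, h₃, mul_assoc]⟩,
      a₂ * b₂, by rw [mul_assoc, h₄, ← mul_assoc, h₂, mul_assoc]⟩

lemma QuantumTorus.ringHom_ext_toTorus {ι : Type} {q : Matrix ι ι Kˣ} {B : Type*} [Semiring B]
    {φ ψ : QuantumTorus q →+* B} (h : ∀ a, φ (toTorus q a) = ψ (toTorus q a)) : φ = ψ :=
  ringHom_ext (fun r => by simpa using h (algebraMap K _ r))
    fun i => by simpa using h (QuantumAffine.x q i)

variable {n : ℕ} {q : Matrix (Fin n) (Fin n) Kˣ} {N : Type*} [AddCommGroup N]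
  [Module (QuantumAffine q)ᵐᵒᵖ N]

lemma exists_extendsAction
    (h : ∀ i, Function.Bijective fun v : N => op (QuantumAffine.x q i) • v) :
    ∃ _inst : Module (QuantumTorus q)ᵐᵒᵖ N, ExtendsAction q N := by
  let : Module K N := Module.compHom N (algebraMap K (QuantumAffine q)ᵐᵒᵖ)
  have : IsScalarTower K (QuantumAffine q)ᵐᵒᵖ N := .of_algebraMap_smul fun _ _ => rfl
  let ρ : QuantumAffine q →ₐ[K] (Module.End K N)ᵐᵒᵖ := AlgHom.opComm.symm (Algebra.lsmul K K N)
  have h_unit (i) : IsUnit (ρ (QuantumAffine.x q i)) :=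
    isUnit_op.2 ((Module.End.isUnit_iff _).2 (h i))
  choose f hf using h_unit
  let φ : QuantumTorus q →ₐ[K] (Module.End K N)ᵐᵒᵖ := QuantumTorus.lift f fun i j => by
    rw [hf, hf, ((QuantumAffine.skewCommute_x i j).map ρ).eq]
  have hφ (a) : φ (toTorus q a) = ρ a := by
    induction a using QuantumAffine.induction with
    | algebraMap r => simp only [AlgHom.commutes]
    | x i => rw [toTorus_x, QuantumTorus.lift_x, hf]
    | add a b ha hb => simp only [map_add, ha, hb]
    | mul a b ha hb => simp only [map_mul, ha, hb]
  exact ⟨Module.compHom N (AlgHom.opComm φ).toRingHom, fun a v =>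
    congrArg (fun g : (Module.End K N)ᵐᵒᵖ => g.unop v) (hφ a)⟩

lemma ExtendsAction.unique {M₁ M₂ : Module (QuantumTorus q)ᵐᵒᵖ N}
    (h₁ : @ExtendsAction K _ n q N _ _ M₁) (h₂ : @ExtendsAction K _ n q N _ _ M₂) : M₁ = M₂ := by
  let φ (M : Module (QuantumTorus q)ᵐᵒᵖ N) : QuantumTorus q →+* (AddMonoid.End N)ᵐᵒᵖ :=
    RingHom.unop ((RingEquiv.opOp (AddMonoid.End N)).toRingHom.comp
      (@Module.toAddMonoidEnd (QuantumTorus q)ᵐᵒᵖ N _ _ M))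
  have h : φ M₁ = φ M₂ := QuantumTorus.ringHom_ext_toTorus fun a =>
    unop_injective (AddMonoidHom.ext fun v => (h₁ a v).trans (h₂ a v).symm)
  exact Module.ext' _ _ fun a v =>
    DFunLike.congr_fun (congrArg unop (DFunLike.congr_fun h a.unop)) v

lemma ExtendsAction.isSimpleModule [Module (QuantumTorus q)ᵐᵒᵖ N]
    [IsSimpleModule (QuantumAffine q)ᵐᵒᵖ N] (h : ExtendsAction q N) :
    IsSimpleModule (QuantumTorus q)ᵐᵒᵖ N := by
  have : Nontrivial N := IsSimpleModule.nontrivial (QuantumAffine q)ᵐᵒᵖ N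
  refine (isSimpleModule_iff _ _).2 { eq_bot_or_eq_top := fun P => ?_ }
  let P' : Submodule (QuantumAffine q)ᵐᵒᵖ N :=
    { P.toAddSubmonoid with
      smul_mem' := fun a v hv => by
        rw [← op_unop a, ← h]
        exact P.smul_mem _ hv }
  refine (eq_bot_or_eq_top P').imp (fun hP => ?_) fun hP => ?_
  all_goals exact SetLike.ext fun v => SetLike.ext_iff.1 hP v

end Extension

section SkewGenerators

variable {R A : Type*} [CommRing R] [Ring A] [Algebra R A]

lemma SkewCommute.adjoin_mul_le {r : Rˣ} {u v : A} (h : SkewCommute r u v) :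
    Subalgebra.toSubmodule (Algebra.adjoin R {u}) * Subalgebra.toSubmodule (Algebra.adjoin R {v}) ≤
      Subalgebra.toSubmodule (Algebra.adjoin R {v}) *
        Subalgebra.toSubmodule (Algebra.adjoin R {u}) := by
  simp only [Algebra.adjoin_eq_span, ← Submonoid.powers_eq_closure, Submodule.span_mul_span]
  rw [Submodule.span_le]
  rintro _ ⟨_, ⟨a, rfl⟩, _, ⟨b, rfl⟩, rfl⟩
  change u ^ a * v ^ b ∈ _
  rw [((h.pow_left a).pow_right b).eq]
  exact Submodule.smul_mem _ _ (Submodule.subset_span (Set.mul_mem_mul ⟨b, rfl⟩ ⟨a, rfl⟩))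

lemma SkewCommute.commute_adjoin {r : Rˣ} {u v : A} (h : SkewCommute r u v) :
    Commute (Subalgebra.toSubmodule (Algebra.adjoin R {u}))
      (Subalgebra.toSubmodule (Algebra.adjoin R {v})) :=
  le_antisymm h.adjoin_mul_le h.symm.adjoin_mul_le

lemma finite_of_skewCommute {ι : Type*} [Finite ι] {x : ι → A} {r : ι → ι → Rˣ}
    (hx : ∀ i j, SkewCommute (r i j) (x i) (x j)) (hgen : Algebra.adjoin R (Set.range x) = ⊤)
    (hint : ∀ i, IsIntegral R (x i)) : Module.Finite R A := by
  classical
  have := Fintype.ofFinite ι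
  let S (i : ι) : Submodule R A := Subalgebra.toSubmodule (Algebra.adjoin R {x i})
  have h_comm : (Set.univ : Set ι).Pairwise fun i j => Commute (S i) (S j) :=
    fun i _ j _ _ => (hx i j).commute_adjoin
  -- the span of the ordered monomials in the `x i`
  let W : Submodule R A := Finset.univ.noncommProd S (by simpa using h_comm)
  have h_idem : W * W = W := by
    rw [← Finset.noncommProd_mul_distrib S S _ _ (by simpa using h_comm)]
    exact Finset.noncommProd_congr rfl
      (fun i _ => (Algebra.adjoin R {x i}).isIdempotentElem_toSubmodule.eq) _
  have h_one (s : Finset ι) : 1 ≤ s.noncommProd S (h_comm.mono (Set.subset_univ _)) :=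
    Finset.noncommProd_induction _ S _ (1 ≤ ·) (fun _ _ => one_le_mul) le_rfl
      fun i _ => Submodule.one_le.2 (one_mem (Algebra.adjoin R {x i}))
  have h_mem (i : ι) : x i ∈ W := by
    have h := Finset.mul_noncommProd_erase Finset.univ (Finset.mem_univ i) S (by simpa using h_comm)
    rw [← mul_one (x i)]
    exact h.le (Submodule.mul_mem_mul (Algebra.self_mem_adjoin_singleton R (x i))
      (Submodule.one_le.1 (h_one _)))
  have h_fg : W.FG :=
    Finset.noncommProd_induction _ S _ Submodule.FG (fun _ _ => Submodule.FG.mul)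
      (Submodule.one_eq_span (R := R) (A := A) ▸ Submodule.fg_span_singleton 1)
      fun i _ => (hint i).fg_adjoin_singleton
  let W' : Subalgebra R A := W.toSubalgebra (Submodule.one_le.1 (h_one _)) fun a b ha hb =>
    h_idem.le (Submodule.mul_mem_mul ha hb)
  have h_le : Algebra.adjoin R (Set.range x) ≤ W' :=
    Algebra.adjoin_le (by rintro _ ⟨i, rfl⟩; exact h_mem i)
  have h_top : W = ⊤ := eq_top_iff.2 fun a _ => h_le (hgen.ge Algebra.mem_top)
  exact ⟨h_top ▸ h_fg⟩

end SkewGenerators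

section FiniteDimensional

lemma isMaximal_annihilator (R A N : Type*) [CommRing R] [Ring A] [Algebra R A]
    [AddCommGroup N] [Module R N] [Module A N] [IsScalarTower R A N] [IsSimpleModule A N]
    [Module.Finite R N] : (Module.annihilator R N).IsMaximal := by
  have : Nontrivial N := IsSimpleModule.nontrivial A N
  refine Ideal.isMaximal_iff.2 ⟨fun h => ?_, fun J r hJ hr hrJ => ?_⟩
  · obtain ⟨v, hv⟩ := exists_ne (0 : N)
    exact hv (by simpa using Module.mem_annihilator.1 h v)
  · have h_surj : Function.Surjective (Algebra.lsmul R A N r) :=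
      (LinearMap.surjective_or_eq_zero _).resolve_right fun h =>
        hr (Module.mem_annihilator.2 (LinearMap.congr_fun h))
    obtain ⟨a, ha, ha0⟩ := Submodule.exists_sub_one_mem_and_smul_eq_zero_of_fg_of_le_smul
      (Ideal.span {r}) (⊤ : Submodule R N) Module.Finite.fg_top fun v _ => by
        obtain ⟨w, rfl⟩ := h_surj v
        exact Submodule.smul_mem_smul (Ideal.mem_span_singleton_self r) Submodule.mem_top
    have haJ : a ∈ J := hJ (Module.mem_annihilator.2 fun v => ha0 v Submodule.mem_top)
    have ha1 : a - 1 ∈ J := (Ideal.span_singleton_le_iff_mem J).2 hrJ ha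
    simpa using J.sub_mem haJ ha1

lemma finite_of_finite_of_finiteType (K R A N : Type*) [Field K] [CommRing R] [Algebra K R]
    [Algebra.FiniteType K R] [Ring A] [Algebra R A] [Module.Finite R A] [AddCommGroup N]
    [Module K N] [Module R N] [IsScalarTower K R N] [Module A N] [IsScalarTower R A N]
    [IsSimpleModule A N] : Module.Finite K N := by
  have : Module.Finite R N := Module.Finite.trans A N
  have := isMaximal_annihilator R A N
  let := Ideal.Quotient.field (Module.annihilator R N)
  let := Module.quotientAnnihilator (R := R) (M := N)
  have : Module.Finite K (R ⧸ Module.annihilator R N) := finite_of_finite_type_of_isJacobsonRing _ _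
  have : IsScalarTower K (R ⧸ Module.annihilator R N) N :=
    (Module.isTorsionBySet_annihilator R N).isScalarTower
  have : IsScalarTower R (R ⧸ Module.annihilator R N) N :=
    (Module.isTorsionBySet_annihilator R N).isScalarTower
  have := Module.Finite.of_restrictScalars_finite R (R ⧸ Module.annihilator R N) N
  exact Module.Finite.trans (R ⧸ Module.annihilator R N) N

lemma finite_of_isSimpleModule_of_skewCommute {K A N ι : Type*} [Field K] [Ring A] [Algebra K A]
    [AddCommGroup N] [Module K N] [Module A N] [IsScalarTower K A N] [IsSimpleModule A N]
    [Finite ι] {x : ι → A} (hgen : Algebra.adjoin K (Set.range x) = ⊤) {m : ℕ} (hm : 0 < m)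
    (hx : ∀ i j, ∃ r : Kˣ, SkewCommute r (x i) (x j) ∧ r ^ m = 1) : Module.Finite K N := by
  choose r hx hr using hx
  have h_central (i : ι) : x i ^ m ∈ Subalgebra.center K A := by
    refine Subalgebra.mem_center_iff.2 fun a => Commute.eq <| Commute.symm <|
      Algebra.commute_of_mem_adjoin_of_forall_mem_commute (R := K) (s := Set.range x)
        (hgen.ge Algebra.mem_top) ?_
    rintro _ ⟨j, rfl⟩
    exact SkewCommute.commute (hr i j ▸ (hx i j).pow_left m)
  let R := MvPolynomial ι K
  let f : R →ₐ[K] A :=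
    (Subalgebra.center K A).val.comp (MvPolynomial.aeval fun i => ⟨x i ^ m, h_central i⟩)
  let : Algebra R A := f.toRingHom.toAlgebra' fun p a =>
    ((Subalgebra.mem_center_iff (R := K)).1 (SetLike.coe_mem _) a).symm
  let : Module R N := Module.compHom N f.toRingHom
  have : IsScalarTower K R A := .of_algebraMap_eq fun c => (f.commutes c).symm
  have : IsScalarTower R A N := .of_algebraMap_smul fun _ _ => rfl
  have : IsScalarTower K R N := .of_algebraMap_smul fun c v => by
    rw [← algebraMap_smul A, ← algebraMap_smul A c, ← IsScalarTower.algebraMap_apply]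
  have : Module.Finite R A := by
    refine finite_of_skewCommute (x := x) (r := fun i j => (r i j).map (algebraMap K R)) ?_ ?_ ?_
    · intro i j
      simpa [SkewCommute] using (hx i j).eq
    · have h_le : Algebra.adjoin K (Set.range x) ≤
          (Algebra.adjoin R (Set.range x)).restrictScalars K :=
        Algebra.adjoin_le Algebra.subset_adjoin
      exact eq_top_iff.2 fun a _ => h_le (hgen.ge Algebra.mem_top)
    · intro i
      have h_pow : algebraMap R A (MvPolynomial.X i) = x i ^ m :=
        congrArg Subtype.val (MvPolynomial.aeval_X _ i)
      exact .of_pow hm (h_pow ▸ isIntegral_algebraMap)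
  exact finite_of_finite_of_finiteType K R A N

namespace QuantumTorus

variable {K : Type u} [Field K] {ι : Type} {q : Matrix ι ι Kˣ}

lemma finite_of_isSimpleModule [Finite ι] {m : ℕ} (hm : 0 < m) (hq : ∀ i j, q i j ^ m = 1)
    (N : Type*) [AddCommGroup N] [Module K N] [Module (QuantumTorus q)ᵐᵒᵖ N]
    [IsScalarTower K (QuantumTorus q)ᵐᵒᵖ N] [IsSimpleModule (QuantumTorus q)ᵐᵒᵖ N] :
    Module.Finite K N := by
  let x' : ι ⊕ ι → (QuantumTorus q)ᵐᵒᵖ :=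
    Sum.elim (fun i => op (xUnit q i : QuantumTorus q))
      fun i => op ((xUnit q i)⁻¹ : (QuantumTorus q)ˣ)
  refine finite_of_isSimpleModule_of_skewCommute (A := (QuantumTorus q)ᵐᵒᵖ) (x := x') ?_ hm ?_
  · suffices h : ∀ a, op a ∈ Algebra.adjoin K (Set.range x') from
      eq_top_iff.2 fun a _ => h a.unop
    intro a
    induction a using QuantumTorus.induction with
    | algebraMap r => exact algebraMap_mem _ r
    | x i => exact Algebra.subset_adjoin ⟨.inl i, rfl⟩
    | x_inv i => exact Algebra.subset_adjoin ⟨.inr i, rfl⟩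
    | add a b ha hb => exact add_mem ha hb
    | mul a b ha hb => exact mul_mem hb ha
  · have h (i j) : SkewCommute (q i j) (xUnit q i : QuantumTorus q) (xUnit q j) :=
      skewCommute_x i j
    rintro (i | i) (j | j)
    · exact ⟨_, (h j i).op, hq j i⟩
    · exact ⟨_, (h j i).inv_left.op, by rw [inv_pow, hq, inv_one]⟩
    · exact ⟨_, (h j i).inv_right.op, by rw [inv_pow, hq, inv_one]⟩
    · exact ⟨_, (h j i).inv_left.inv_right.op, by rw [inv_inv, hq]⟩

end QuantumTorus

end FiniteDimensional

section WeightedShift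

variable {K : Type u} [Field K] {I : Type} [AddCommGroup I]

lemma shiftMap_mul_shiftMap (w w' : I → Kˣ) (d d' : I) :
    shiftMap w d * shiftMap w' d' = shiftMap (fun a => w' a * w (a + d')) (d' + d) :=
  Finsupp.lhom_ext fun a r => by
    simp only [Module.End.mul_apply, shiftMap_single, Units.val_mul, mul_assoc, add_assoc]

lemma shiftMap_zero_apply (w : I → Kˣ) (f : I →₀ K) (a : I) : shiftMap w 0 f a = w a * f a := by
  classical
  induction f using Finsupp.induction_linear with
  | zero => simp
  | add f g hf hg => simp only [map_add, Finsupp.add_apply, hf, hg, mul_add]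
  | single b r => by_cases h : b = a <;> simp [shiftMap_single, h, mul_comm]

lemma single_apply_mem_of_shiftMap_zero_mem {J : Type*} {w : J → I → Kˣ}
    (hw : Function.Injective fun a j => w j a) {P : Submodule K (I →₀ K)}
    (hP : ∀ j, ∀ f ∈ P, shiftMap (w j) 0 f ∈ P) {f : I →₀ K} (hf : f ∈ P) (a : I) :
    Finsupp.single a (f a) ∈ P := by
  classical
  induction hs : f.support using Finset.strongInduction generalizing f with
  | H s ih =>
    subst hs
    by_cases h_supp : f.support ⊆ {a}
    · rwa [← Finsupp.support_subset_singleton.1 h_supp]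
    obtain ⟨b, hb, hba⟩ := Finset.not_subset.1 h_supp
    obtain ⟨j, hj⟩ : ∃ j, w j a ≠ w j b := Function.ne_iff.1 (hw.ne (by simpa [eq_comm] using hba))
    -- Combining `f` with its image under `w j` kills the coefficient at `b`.
    let g : I →₀ K := (w j a - w j b : K)⁻¹ • (shiftMap (w j) 0 f - (w j b : K) • f)
    have hg (i) : g i = (w j a - w j b : K)⁻¹ * ((w j i - w j b) * f i) := by
      simp [g, shiftMap_zero_apply, sub_mul]
    have hgP : g ∈ P := P.smul_mem _ (P.sub_mem (hP j f hf) (P.smul_mem _ hf))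
    have hga : g a = f a := by
      rw [hg, inv_mul_cancel_left₀ (sub_ne_zero.2 fun h => hj (Units.ext h))]
    rw [← hga]
    refine ih _ (Finset.ssubset_iff_of_subset (fun i hi => ?_) |>.2 ⟨b, hb, ?_⟩) hgP rfl
    · rw [Finsupp.mem_support_iff, hg] at hi
      exact Finsupp.mem_support_iff.2 (right_ne_zero_of_mul (right_ne_zero_of_mul hi))
    · simp [hg]

lemma eq_bot_or_eq_top_of_shiftMap_mem {J L : Type*} {w : J → I → Kˣ}
    (hw : Function.Injective fun a j => w j a) {u : L → I → Kˣ} {d : L → I}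
    (hd : AddSubmonoid.closure (Set.range d) = ⊤) {P : Submodule K (I →₀ K)}
    (hwP : ∀ j, ∀ f ∈ P, shiftMap (w j) 0 f ∈ P)
    (huP : ∀ l, ∀ f ∈ P, shiftMap (u l) (d l) f ∈ P) : P = ⊥ ∨ P = ⊤ := by
  refine or_iff_not_imp_left.2 fun h_bot => ?_
  have smul_mem_iff (a : I) {r : K} (hr : r ≠ 0) :
      Finsupp.single a r ∈ P ↔ Finsupp.single a 1 ∈ P := by
    rw [← P.smul_mem_iff hr (x := Finsupp.single a 1), Finsupp.smul_single_one]
  obtain ⟨f, hf, hf0⟩ := Submodule.exists_mem_ne_zero_of_ne_bot h_bot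
  obtain ⟨a₀, ha₀⟩ := Finsupp.ne_iff.1 hf0
  have h_start : Finsupp.single a₀ 1 ∈ P :=
    (smul_mem_iff a₀ ha₀).1 (single_apply_mem_of_shiftMap_zero_mem hw hwP hf a₀)
  have h_single (b : I) : Finsupp.single (a₀ + b) 1 ∈ P := by
    induction hd.ge (AddSubmonoid.mem_top b) using AddSubmonoid.closure_induction_right with
    | zero => rwa [add_zero]
    | add_right b _ c hc ih =>
      obtain ⟨l, rfl⟩ := hc
      have h := huP l _ ih
      rwa [shiftMap_single, one_mul, smul_mem_iff _ (Units.ne_zero _), add_assoc] at h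
  refine eq_top_iff.2 fun f _ => ?_
  rw [← Finsupp.sum_single f]
  refine P.sum_mem fun a ha => (smul_mem_iff a (Finsupp.mem_support_iff.1 ha)).2 ?_
  simpa using h_single (a - a₀)

lemma closure_range_pi_single_one_eq_top {ι : Type*} [Finite ι] [DecidableEq ι] {k : ι → ℕ}
    [∀ i, NeZero (k i)] :
    AddSubmonoid.closure (Set.range fun i => (Pi.single i 1 : ∀ i, ZMod (k i))) = ⊤ := by
  have := Fintype.ofFinite ι
  refine eq_top_iff.2 fun a _ => ?_
  rw [← Finset.univ_sum_single a]
  refine AddSubmonoid.sum_mem _ fun i _ => ?_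
  have h : Pi.single i (a i) = (a i).val • (Pi.single i 1 : ∀ i, ZMod (k i)) := by
    rw [← Pi.single_smul, nsmul_one, ZMod.natCast_zmod_val]
  exact h ▸ AddSubmonoid.nsmul_mem _ (AddSubmonoid.subset_closure (Set.mem_range_self i)) _

end WeightedShift

section BlockModel

variable {K : Type u} [Field K] {s t : ℕ} {k : Fin s → ℕ} {c : Fin s → Kˣ}

lemma blockRep_x_apply (hc : ∀ i, c i ^ k i = 1) (α : BlockIndex s t → Kˣ) (x : BlockIndex s t)
    (f : (∀ i, ZMod (k i)) →₀ K) :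
    (blockRep k c hc α (QuantumTorus.x _ x)).unop f =
      shiftMap (blockCoeff k c α x) (blockShift k x) f := by
  rw [blockRep, QuantumTorus.lift_x]
  rfl

lemma shiftMap_inl_mul_shiftMap_inr (α : BlockIndex s t → Kˣ) (i : Fin s) :
    shiftMap (blockCoeff k c α (.inl i)) (blockShift k (.inl i : BlockIndex s t)) *
        shiftMap (blockCoeff k c α (.inr (.inl i)))
          (blockShift k (.inr (.inl i) : BlockIndex s t)) =
      shiftMap (fun a => α (.inr (.inl i)) * c i ^ (((a i).cast : ℤ) - 1)) 0 := by
  rw [shiftMap_mul_shiftMap]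
  congr 1
  · funext a
    simp only [blockCoeff, mul_assoc, mul_comm _ (α (.inl i)), mul_inv_cancel_left]
  · simp [blockShift, ← Pi.single_add]

lemma eq_bot_or_eq_top_of_blockModel [∀ i, NeZero (k i)] (hc : ∀ i, orderOf (c i) = k i)
    {α : BlockIndex s t → Kˣ} {P : Submodule K ((∀ i, ZMod (k i)) →₀ K)}
    (hP : ∀ x, ∀ f ∈ P, shiftMap (blockCoeff k c α x) (blockShift k x) f ∈ P) :
    P = ⊥ ∨ P = ⊤ := by
  refine eq_bot_or_eq_top_of_shiftMap_mem
    (w := fun i a => α (.inr (.inl i)) * c i ^ (((a i).cast : ℤ) - 1)) (fun a b hab => ?_)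
    closure_range_pi_single_one_eq_top (fun i f hf => ?_) fun i => hP (.inl i)
  · funext i
    have h := mul_left_cancel (congrFun hab i)
    rw [zpow_eq_zpow_iff_modEq, hc, ← ZMod.intCast_eq_intCast_iff] at h
    simpa using h
  · rw [← shiftMap_inl_mul_shiftMap_inr]
    exact hP _ _ (hP _ _ hf)

end BlockModel

section Eigenvectors

variable {K V : Type*} [Field K] [AddCommGroup V] [Module K V]

lemma exists_forall_smul_eq_smul_of_central [IsAlgClosed K] [Module.Finite K V] {A : Type*}
    [Ring A] [Algebra K A] [Module A V] [IsScalarTower K A V] [IsSimpleModule A V] {z : A}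
    (hz : ∀ a, Commute z a) : ∃ r : K, ∀ v : V, z • v = r • v := by
  let f : Module.End A V :=
    { DistribSMul.toAddMonoidHom V z with
      map_smul' := fun a v => by
        change z • a • v = a • z • v
        rw [smul_smul, (hz a).eq, mul_smul] }
  obtain ⟨r, hr⟩ := (IsSimpleModule.algebraMap_end_bijective_of_isAlgClosed K).2 f
  exact ⟨r, fun v => (LinearMap.congr_fun hr v).symm⟩

lemma exists_units_eq_of_smul_eq_smul {u : (Module.End K V)ˣ} {r : K} {v : V} (hv : v ≠ 0)
    (h : u • v = r • v) : ∃ r' : Kˣ, (r' : K) = r :=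
  ⟨Units.mk0 r fun hr => hv (by rwa [hr, zero_smul, smul_eq_zero_iff_eq] at h), rfl⟩

lemma exists_forall_smul_eq_smul_of_commute [IsAlgClosed K] [Module.Finite K V] [Nontrivial V]
    {κ : Type*} {f : κ → (Module.End K V)ˣ} (hf : ∀ i j, Commute (f i) (f j)) :
    ∃ v : V, v ≠ 0 ∧ ∀ i, ∃ μ : Kˣ, f i • v = μ • v := by
  let A := Algebra.adjoin K (Set.range fun i => (f i : Module.End K V))
  have : IsMulCommutative A := Algebra.isMulCommutative_adjoin K <| by
    rintro _ ⟨i, rfl⟩ _ ⟨j, rfl⟩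
    exact congrArg Units.val (hf i j).eq
  have : IsArtinian A V := isArtinian_of_tower K inferInstance
  obtain ⟨W, hW⟩ := IsAtomic.exists_atom (Submodule A V)
  have : IsSimpleModule A W := isSimpleModule_iff_isAtom.2 hW
  have : Module.Finite K W := .of_injective (W.subtype.restrictScalars K) Subtype.val_injective
  have : Nontrivial W := IsSimpleModule.nontrivial A W
  obtain ⟨w, hw⟩ := exists_ne (0 : W)
  have h_line := (finrank_eq_one_iff_of_nonzero' w hw).1
    (IsSimpleModule.finrank_eq_one_of_isMulCommutative A W K)
  refine ⟨w, Subtype.coe_ne_coe.2 hw, fun i => ?_⟩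
  obtain ⟨μ, hμ⟩ := h_line ((⟨f i, Algebra.subset_adjoin ⟨i, rfl⟩⟩ : A) • w)
  have hμ : f i • (w : V) = μ • (w : V) := (congrArg Subtype.val hμ).symm
  obtain ⟨μ, rfl⟩ := exists_units_eq_of_smul_eq_smul (Subtype.coe_ne_coe.2 hw) hμ
  exact ⟨μ, hμ⟩

lemma SkewCommute.apply_apply_eq_smul {r : Kˣ} {f g : Module.End K V} (h : SkewCommute r f g)
    {μ : K} {v : V} (hv : f v = μ • v) : f (g v) = (r * μ : K) • g v := by
  have h' := LinearMap.congr_fun h.eq v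
  rwa [Module.End.mul_apply, LinearMap.smul_apply, Module.End.mul_apply, hv, map_smul,
    smul_smul] at h'

end Eigenvectors

section Orbit

variable {ι : Type*} [Finite ι] [DecidableEq ι] {k : ι → ℕ}

lemma exists_orbit_pi_zmod {G X : Type*} [Group G] [MulAction G X] {S : ι → G}
    (hS : ∀ i, S i ^ k i = 1) (hcomm : ∀ i j, Commute (S i) (S j)) (v : X) :
    ∃ e : (∀ i, ZMod (k i)) → X, e 0 = v ∧ ∀ i a, e (a + Pi.single i 1) = S i • e a := by
  have := Fintype.ofFinite ι
  let ψ (i : ι) : ZMod (k i) →+ Additive G := ZMod.lift (k i)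
    ⟨zmultiplesHom _ (Additive.ofMul (S i)), by
      rw [zmultiplesHom_apply, natCast_zsmul, ← ofMul_pow, hS, ofMul_one]⟩
  have hψ (i : ι) (n : ℤ) : ψ i n = n • Additive.ofMul (S i) := by
    rw [ZMod.lift_coe, zmultiplesHom_apply]
  have hψ_comm : Pairwise fun i j => ∀ x y, AddCommute (ψ i x) (ψ j y) := by
    intro i j _ x y
    obtain ⟨x, rfl⟩ := ZMod.intCast_surjective x
    obtain ⟨y, rfl⟩ := ZMod.intCast_surjective y
    have h : AddCommute (Additive.ofMul (S i)) (Additive.ofMul (S j)) :=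
      congrArg Additive.ofMul (hcomm i j).eq
    rw [hψ, hψ]
    exact h.zsmul_zsmul x y
  let φ : (∀ i, ZMod (k i)) →+ Additive G := AddMonoidHom.noncommPiCoprod ψ hψ_comm
  have hφ (i : ι) : φ (Pi.single i 1) = Additive.ofMul (S i) := by
    rw [AddMonoidHom.noncommPiCoprod_single, ← Int.cast_one, hψ, one_zsmul]
  refine ⟨fun a => (φ a).toMul • v, by simp, fun i a => ?_⟩
  simp only [add_comm a, map_add, hφ, toMul_add, toMul_ofMul, mul_smul]

lemma apply_orbit_eq_smul {K V : Type*} [Field K] [AddCommGroup V] [Module K V]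
    [∀ i, NeZero (k i)] {i : ι} {c : Kˣ} (hc : c ^ k i = 1) {D : Module.End K V}
    {S : ι → Module.End K V} (hDS : ∀ j, SkewCommute (if j = i then c else 1) D (S j))
    {b : ι → Kˣ} {e : (∀ i, ZMod (k i)) → V}
    (he : ∀ j a, e (a + Pi.single j 1) = b j • S j (e a)) {μ : K} (h₀ : D (e 0) = μ • e 0)
    (a : ∀ i, ZMod (k i)) :
    D (e a) = ((c ^ ((a i).cast : ℤ) : Kˣ) * μ : K) • e a := by
  induction closure_range_pi_single_one_eq_top.ge (AddSubmonoid.mem_top a)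
    using AddSubmonoid.closure_induction_right with
  | zero => simpa using h₀
  | add_right a _ d hd ih =>
    obtain ⟨j, rfl⟩ := hd
    have h_weight : c ^ (((a + Pi.single j 1 : ∀ i, ZMod (k i)) i).cast : ℤ) =
        (if j = i then c else 1) * c ^ ((a i).cast : ℤ) := by
      split_ifs with h
      · subst h
        rw [Pi.add_apply, Pi.single_eq_same, ← Int.cast_one, zpow_cast_add hc, add_comm,
          zpow_one_add]
      · rw [Pi.add_apply, Pi.single_eq_of_ne' h, add_zero, one_mul]
    rw [h_weight, Units.val_mul, mul_assoc, he, LinearMap.map_smul_of_tower,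
      (hDS j).apply_apply_eq_smul ih, smul_comm]

end Orbit

section ModelVectors

section BlockRelations

variable {K B : Type*} [Field K] [Ring B] [Algebra K B] {s t : ℕ} {c : Fin s → Kˣ}
  {T : BlockIndex s t → B}

lemma skewCommute_inl_mul_inr_inl (hT : ∀ x y, SkewCommute (blockMatrix c x y) (T y) (T x))
    (i j : Fin s) :
    SkewCommute (if j = i then c i else 1) (T (.inl i) * T (.inr (.inl i))) (T (.inl j)) := by
  have h := (hT (.inl j) (.inl i)).mul_left (hT (.inl j) (.inr (.inl i)))
  rcases eq_or_ne j i with rfl | hji <;> simpa [blockMatrix, *] using h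

lemma skewCommute_inl_mul_inr_inr (hT : ∀ x y, SkewCommute (blockMatrix c x y) (T y) (T x))
    (i j : Fin s) :
    SkewCommute (if j = i then (c i)⁻¹ else 1) (T (.inl i) * T (.inr (.inl i)))
      (T (.inr (.inl j))) := by
  have h := (hT (.inr (.inl j)) (.inl i)).mul_left (hT (.inr (.inl j)) (.inr (.inl i)))
  rcases eq_or_ne j i with rfl | hji <;> simpa [blockMatrix, *] using h

lemma commute_inl_mul_inr (hT : ∀ x y, SkewCommute (blockMatrix c x y) (T y) (T x))
    (i j : Fin s) :
    Commute (T (.inl i) * T (.inr (.inl i))) (T (.inl j) * T (.inr (.inl j))) := by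
  have h := (skewCommute_inl_mul_inr_inl hT i j).mul_right (skewCommute_inl_mul_inr_inr hT i j)
  refine SkewCommute.commute (R := K) ?_
  split_ifs at h <;> simpa using h

end BlockRelations

variable {K V : Type*} [Field K] [IsAlgClosed K] [AddCommGroup V] [Module K V] {s t : ℕ}
  {k : Fin s → ℕ} [∀ i, NeZero (k i)] {c : Fin s → Kˣ} {T : BlockIndex s t → (Module.End K V)ˣ}

lemma exists_cyclic_orbit [Nontrivial V] {S : Fin s → (Module.End K V)ˣ}
    (hS : ∀ i j, Commute (S i) (S j)) (hSk : ∀ i, ∃ r : K, ∀ v : V, S i ^ k i • v = r • v)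
    (v : V) : ∃ (β : Fin s → Kˣ) (e : (∀ i, ZMod (k i)) → V),
      e 0 = v ∧ ∀ i a, e (a + Pi.single i 1) = (β i)⁻¹ • S i • e a := by
  have h_root (i) : ∃ β : Kˣ, ∀ v : V, S i ^ k i • v = β ^ k i • v := by
    obtain ⟨r, hr⟩ := hSk i
    obtain ⟨v, hv⟩ := exists_ne (0 : V)
    obtain ⟨b, hb⟩ := IsAlgClosed.exists_pow_nat_eq r (NeZero.pos (k i))
    obtain ⟨r, rfl⟩ := exists_units_eq_of_smul_eq_smul hv (hr v)
    obtain ⟨b, rfl⟩ := (isUnit_pow_iff (NeZero.ne (k i))).1 (hb ▸ r.isUnit)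
    exact ⟨b, fun v => (hr v).trans (by rw [← hb]; rfl)⟩
  choose β hβ using h_root
  let σ : Kˣ →* (Module.End K V)ˣ := Units.map (algebraMap K (Module.End K V)).toMonoidHom
  have hσ (b : Kˣ) (u : (Module.End K V)ˣ) : Commute (σ b) u :=
    Units.ext (Algebra.commutes (b : K) (u : Module.End K V))
  have hσ_smul (b : Kˣ) (w : V) : σ b • w = b • w := Module.algebraMap_end_apply _ _ _ _ _
  obtain ⟨e, he₀, he⟩ := exists_orbit_pi_zmod (k := k) (S := fun i => σ (β i)⁻¹ * S i)
    (fun i => by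
      rw [(hσ _ _).mul_pow, ← map_pow, inv_pow, map_inv, inv_mul_eq_one]
      exact Units.ext (LinearMap.ext fun w => (hσ_smul _ w).trans (hβ i w).symm))
    (fun i j => ((hσ _ _).mul_right (hσ _ _)).mul_left ((hσ _ _).symm.mul_right (hS i j))) v
  exact ⟨β, e, he₀, fun i a => by rw [he, mul_smul, hσ_smul]⟩

lemma exists_model_vectors [Module.Finite K V] [Nontrivial V] (hc : ∀ i, c i ^ k i = 1)
    (hT : ∀ x y, SkewCommute (blockMatrix c x y) (T y : Module.End K V) (T x))
    (hX : ∀ i, ∃ r : K, ∀ v : V, T (.inl i) ^ k i • v = r • v)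
    (hZ : ∀ j, ∃ r : K, ∀ v : V, T (.inr (.inr j)) • v = r • v) :
    ∃ (α : BlockIndex s t → Kˣ) (e : (∀ i, ZMod (k i)) → V), e 0 ≠ 0 ∧
      ∀ x a, T x • e a = blockCoeff k c α x a • e (a + blockShift k x) := by
  let D (i : Fin s) : (Module.End K V)ˣ := T (.inl i) * T (.inr (.inl i))
  have hDD (i j) : Commute (D i) (D j) := Units.ext (commute_inl_mul_inr hT i j).eq
  obtain ⟨v, hv, hμ⟩ := exists_forall_smul_eq_smul_of_commute (K := K) hDD
  choose μ hμ using hμ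
  choose γ' hγ' using hZ
  have h_unit (j) := exists_units_eq_of_smul_eq_smul hv (hγ' j v)
  choose γ hγ using h_unit
  obtain ⟨β, e, he₀, he⟩ := exists_cyclic_orbit (S := fun i => T (.inl i))
    (fun i j => Units.ext (SkewCommute.commute (hT (.inl j) (.inl i))).eq) hX v
  have hX' (i a) : T (.inl i) • e a = β i • e (a + Pi.single i 1) := by
    rw [he, smul_inv_smul]
  have hD (i a) : D i • e a = (c i ^ ((a i).cast : ℤ) * μ i) • e a := by
    subst he₀
    exact apply_orbit_eq_smul (hc i) (skewCommute_inl_mul_inr_inl hT i) he (hμ i) a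
  let α : BlockIndex s t → Kˣ := Sum.elim β (Sum.elim (fun i => c i * μ i) γ)
  refine ⟨α, e, he₀ ▸ hv, ?_⟩
  rintro (i | i | j) a
  · exact hX' i a
  · refine smul_left_cancel (T (.inl i)) ?_
    have h_shift : a + blockShift k (.inr (.inl i) : BlockIndex s t) + Pi.single i 1 = a := by
      simp [blockShift, add_assoc, ← Pi.single_add]
    rw [smul_smul, smul_comm, hX', h_shift]
    refine (hD i a).trans ?_
    rw [smul_smul]
    congr 1
    simp only [α, blockCoeff, Sum.elim_inl, Sum.elim_inr, zpow_sub_one]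
    rw [mul_comm _ (β i), mul_assoc (β i)⁻¹, mul_inv_cancel_left, mul_comm _ (c i)⁻¹,
      mul_mul_mul_comm, mul_inv_cancel, one_mul, mul_comm]
  · rw [blockShift, add_zero]
    exact (hγ' j (e a)).trans (by rw [← hγ]; rfl)

end ModelVectors

section OppositeUnits

variable {A N : Type*} [Ring A] [AddCommGroup N] [Module Aᵐᵒᵖ N]

lemma op_inv_smul_op_smul (u : Aˣ) (v : N) :
    op ((u⁻¹ : Aˣ) : A) • op (u : A) • v = v := by
  rw [smul_smul, ← op_mul, Units.mul_inv, op_one, one_smul]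

lemma op_smul_op_inv_smul (u : Aˣ) (v : N) :
    op (u : A) • op ((u⁻¹ : Aˣ) : A) • v = v := by
  rw [smul_smul, ← op_mul, Units.inv_mul, op_one, one_smul]

end OppositeUnits

namespace QuantumTorus

variable {K : Type u} [Field K] {ι : Type} {q : Matrix ι ι Kˣ}

lemma commute_of_commute_x {z : QuantumTorus q} (hz : ∀ i, Commute z (x q i))
    (a : QuantumTorus q) : Commute z a := by
  induction a using QuantumTorus.induction with
  | algebraMap r => exact (Algebra.commutes r z).symm
  | x i => exact hz i
  | x_inv i => exact Commute.units_inv_right (u := xUnit q i) (hz i)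
  | add a b ha hb => exact ha.add_right hb
  | mul a b ha hb => exact ha.mul_right hb

lemma map_smul_of_map_x_smul {A M N : Type*} [Ring A] [Algebra K A]
    [AddCommGroup M] [Module K M] [Module Aᵐᵒᵖ M] [IsScalarTower K Aᵐᵒᵖ M]
    [AddCommGroup N] [Module K N] [Module Aᵐᵒᵖ N] [IsScalarTower K Aᵐᵒᵖ N]
    {φ : QuantumTorus q →ₐ[K] A} {f : M →ₗ[K] N}
    (hf : ∀ i v, f (op (φ (x q i)) • v) = op (φ (x q i)) • f v) (a : QuantumTorus q) :
    ∀ v, f (op (φ a) • v) = op (φ a) • f v := by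
  induction a using QuantumTorus.induction with
  | algebraMap r =>
    intro v
    rw [AlgHom.commutes, ← MulOpposite.algebraMap_apply, algebraMap_smul, algebraMap_smul, map_smul]
  | x i => exact hf i
  | x_inv i =>
    intro v
    let u : Aˣ := Units.map (φ : QuantumTorus q →* A) (xUnit q i)
    have hf (w) : f (op (u : A) • w) = op (u : A) • f w := hf i w
    change f (op ((u⁻¹ : Aˣ) : A) • v) = op ((u⁻¹ : Aˣ) : A) • f v
    rw [← op_inv_smul_op_smul u (f _), ← hf, op_smul_op_inv_smul]
  | add a b ha hb =>
    intro v
    rw [map_add, op_add, add_smul, add_smul, map_add, ha, hb]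
  | mul a b ha hb =>
    intro v
    rw [map_mul, op_mul, mul_smul, mul_smul, hb, ha]

lemma smul_mem_of_x_smul_mem {N : Type*} [AddCommGroup N] [Module K N] [Module.Finite K N]
    [Module (QuantumTorus q)ᵐᵒᵖ N] [IsScalarTower K (QuantumTorus q)ᵐᵒᵖ N] {P : Submodule K N}
    (hP : ∀ i, ∀ v ∈ P, op (x q i) • v ∈ P) (a : QuantumTorus q) : ∀ v ∈ P, op a • v ∈ P := by
  induction a using QuantumTorus.induction with
  | algebraMap r =>
    intro v hv
    rw [← MulOpposite.algebraMap_apply, algebraMap_smul]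
    exact P.smul_mem r hv
  | x i => exact hP i
  | x_inv i =>
    have h_inv (w : N) : op (((xUnit q i)⁻¹ : (QuantumTorus q)ˣ) : QuantumTorus q) •
        op (x q i) • w = w := op_inv_smul_op_smul (xUnit q i) w
    -- An injective endomorphism of the finite-dimensional space `P` is onto.
    intro v hv
    have h_inj : Function.Injective ((Algebra.lsmul K K N (op (x q i))).restrict (hP i)) := by
      intro v w h
      refine Subtype.ext ?_
      rw [← h_inv v, ← h_inv w]
      exact congrArg _ (congrArg Subtype.val h)
    obtain ⟨w, hw⟩ := LinearMap.injective_iff_surjective.1 h_inj ⟨v, hv⟩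
    have hw : op (x q i) • (w : N) = v := congrArg Subtype.val hw
    rw [← hw, h_inv]
    exact w.2
  | add a b ha hb =>
    intro v hv
    rw [op_add, add_smul]
    exact add_mem (ha v hv) (hb v hv)
  | mul a b ha hb =>
    intro v hv
    rw [op_mul, mul_smul]
    exact hb _ (ha v hv)

end QuantumTorus

section BlockTorus

variable {K : Type u} [Field K] {s t : ℕ} {k : Fin s → ℕ} {c : Fin s → Kˣ}

lemma linearCombination_shiftMap {I : Type} [AddCommGroup I] {N : Type*} [AddCommGroup N]
    [Module K N] {w : I → Kˣ} {d : I} {e : I → N} {T : Module.End K N}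
    (hT : ∀ a, T (e a) = w a • e (a + d)) (f : I →₀ K) :
    Finsupp.linearCombination K e (shiftMap w d f) = T (Finsupp.linearCombination K e f) := by
  suffices h : Finsupp.linearCombination K e ∘ₗ shiftMap w d =
      T ∘ₗ Finsupp.linearCombination K e from LinearMap.congr_fun h f
  ext a
  simp [shiftMap_single, hT, Units.smul_def]

lemma blockMatrix_inl_pow (hc : ∀ i, c i ^ k i = 1) (i : Fin s) (y : BlockIndex s t) :
    blockMatrix c (.inl i) y ^ k i = 1 := by
  rcases y with _ | j | _
  · exact one_pow _
  · rw [blockMatrix]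
    split_ifs with h
    · exact hc i
    · exact one_pow _
  · exact one_pow _

lemma exists_model_vectors_of_isSimpleModule [IsAlgClosed K] [∀ i, NeZero (k i)]
    (hc : ∀ i, c i ^ k i = 1) {A N : Type*} [Ring A] [Algebra K A]
    (φ : QuantumTorus (blockMatrix (t := t) c) ≃ₐ[K] A) [AddCommGroup N] [Module K N]
    [Module.Finite K N] [Module Aᵐᵒᵖ N] [IsScalarTower K Aᵐᵒᵖ N] [IsSimpleModule Aᵐᵒᵖ N] :
    ∃ (α : BlockIndex s t → Kˣ) (e : (∀ i, ZMod (k i)) → N), e 0 ≠ 0 ∧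
      ∀ x a, op (φ (QuantumTorus.x _ x)) • e a = blockCoeff k c α x a • e (a + blockShift k x) := by
  let ρ : Aᵐᵒᵖ →ₐ[K] Module.End K N := Algebra.lsmul K K N
  let T (x : BlockIndex s t) : (Module.End K N)ˣ := Units.map (ρ : Aᵐᵒᵖ →* Module.End K N)
    (Units.opEquiv.symm (op (Units.map φ.toMulEquiv.toMonoidHom (QuantumTorus.xUnit _ x))))
  have h_scalar {z : QuantumTorus (blockMatrix (t := t) c)}
      (hz : ∀ x, Commute z (QuantumTorus.x _ x)) : ∃ r : K, ∀ v : N, op (φ z) • v = r • v := by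
    refine exists_forall_smul_eq_smul_of_central fun a => ?_
    obtain ⟨b, hb⟩ := φ.surjective a.unop
    have h := ((QuantumTorus.commute_of_commute_x hz b).map φ).op
    rwa [hb, op_unop] at h
  have : Nontrivial N := IsSimpleModule.nontrivial Aᵐᵒᵖ N
  refine exists_model_vectors (T := T) hc
    (fun x y => ((QuantumTorus.skewCommute_x x y).map φ.toAlgHom).op.map ρ) (fun i => ?_)
    fun j => h_scalar fun y => ?_
  · obtain ⟨r, hr⟩ := h_scalar (z := QuantumTorus.x _ (.inl i) ^ k i) fun y =>
      SkewCommute.commute (R := K)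
        (blockMatrix_inl_pow hc i y ▸ (QuantumTorus.skewCommute_x (.inl i) y).pow_left (k i))
    have h_pow : op (φ (QuantumTorus.x _ (.inl i) ^ k i)) =
        op (φ (QuantumTorus.x _ (.inl i))) ^ k i := by rw [map_pow, op_pow]
    refine ⟨r, fun v => .trans ?_ (hr v)⟩
    rw [h_pow]
    exact (LinearMap.congr_fun (map_pow ρ _ _) v).symm
  · exact SkewCommute.commute (R := K) (QuantumTorus.skewCommute_x (.inr (.inr j)) y)

end BlockTorus

namespace NormalForm

variable {K : Type u} [Field K] {n : ℕ} {q : Matrix (Fin n) (Fin n) Kˣ} {ζ : Kˣ}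
  (F : NormalForm q ζ)

lemma h_pos (hm : 0 < orderOf ζ) (i : Fin F.s) : 0 < F.h i :=
  Nat.pos_of_dvd_of_pos (F.h_dvd_order i) hm

lemma neZero_k (hm : 0 < orderOf ζ) (i : Fin F.s) : NeZero (F.k i) :=
  ⟨(Nat.div_pos (Nat.le_of_dvd hm (F.h_dvd_order i)) (F.h_pos hm i)).ne'⟩

lemma orderOf_c (hm : 0 < orderOf ζ) (i : Fin F.s) : orderOf (F.c i) = F.k i := by
  rw [k, ← orderOf_pow_of_dvd (F.h_pos hm i).ne' (F.h_dvd_order i), c, exponent]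
  split_ifs with hi
  · exact F.z_order i hi
  · rfl

lemma idx_injective : Function.Injective F.idx := by
  rintro (i | i | i) (j | j | j) h <;>
    simp only [idx, Sum.inl.injEq, Sum.inr.injEq, Fin.ext_iff] at h ⊢ <;> omega

section Model

variable (α : Fin n → Kˣ)

instance : Nontrivial (F.Model α) := inferInstanceAs (Nontrivial ((∀ i, ZMod (F.k i)) →₀ K))

instance : IsScalarTower K (QuantumTorus q)ᵐᵒᵖ (F.Model α) :=
  .of_algebraMap_smul fun r v =>
    LinearMap.congr_fun (congrArg unop ((F.rep α).commutes r)) v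

lemma extendsAction_model : ExtendsAction q (F.Model α) := fun _ _ => rfl

lemma op_iso_x_smul (x : BlockIndex F.s (n - 2 * F.s)) (v : F.Model α) :
    op (F.iso (QuantumTorus.x _ x)) • v =
      shiftMap (blockCoeff F.k F.c (α ∘ F.idx) x) (blockShift F.k x) v :=
  (congrArg (fun b => (blockRep F.k F.c F.c_pow_k (α ∘ F.idx) b).unop v)
    (F.iso.symm_apply_apply _)).trans (blockRep_x_apply F.c_pow_k _ x v)

lemma isSimpleModule_affine (hm : 0 < orderOf ζ) :
    IsSimpleModule (QuantumAffine q)ᵐᵒᵖ (F.Model α) := by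
  have := F.neZero_k hm
  have : Module.Finite K (F.Model α) :=
    inferInstanceAs (Module.Finite K ((∀ i, ZMod (F.k i)) →₀ K))
  refine (isSimpleModule_iff _ _).2 { eq_bot_or_eq_top := fun P => ?_ }
  let P' : Submodule K (F.Model α) :=
    { P.toAddSubmonoid with
      smul_mem' := fun r v hv => by
        have h := P.smul_mem (op (algebraMap K (QuantumAffine q) r)) hv
        rwa [← F.extendsAction_model α, AlgHom.commutes, ← MulOpposite.algebraMap_apply,
          algebraMap_smul] at h }
  have hP' (a : QuantumTorus q) : ∀ v ∈ P', op a • v ∈ P' := by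
    refine QuantumTorus.smul_mem_of_x_smul_mem (fun i v hv => ?_) a
    rw [← toTorus_x, F.extendsAction_model α]
    exact P.smul_mem _ hv
  refine (eq_bot_or_eq_top_of_blockModel (F.orderOf_c hm) (α := α ∘ F.idx) (P := P')
    fun x f hf => F.op_iso_x_smul α x f ▸ hP' _ f hf).imp (fun h => ?_) fun h => ?_
  all_goals exact SetLike.ext fun v => SetLike.ext_iff.1 h v

lemma variablesActNontrivially : VariablesActNontrivially q (F.Model α) := by
  intro i
  obtain ⟨v, hv⟩ := exists_ne (0 : F.Model α)
  refine ⟨v, fun h => hv ?_⟩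
  rw [← F.extendsAction_model α, toTorus_x, ← QuantumTorus.val_xUnit] at h
  rw [← op_inv_smul_op_smul (QuantumTorus.xUnit q i) v, h, smul_zero]

end Model

lemma exists_linearMap_model_ne_zero [IsAlgClosed K] (hm : 0 < orderOf ζ)
    (hq : ∀ i j, q i j ^ orderOf ζ = 1) (N : Type*) [AddCommGroup N]
    [Module (QuantumTorus q)ᵐᵒᵖ N] [IsSimpleModule (QuantumTorus q)ᵐᵒᵖ N] :
    ∃ (α : Fin n → Kˣ) (f : F.Model α →ₗ[(QuantumTorus q)ᵐᵒᵖ] N), f ≠ 0 := by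
  let : Module K N := Module.compHom N (algebraMap K (QuantumTorus q)ᵐᵒᵖ)
  have : IsScalarTower K (QuantumTorus q)ᵐᵒᵖ N := .of_algebraMap_smul fun _ _ => rfl
  have := F.neZero_k hm
  have : Module.Finite K N := QuantumTorus.finite_of_isSimpleModule hm hq N
  obtain ⟨β, e, he₀, he⟩ := exists_model_vectors_of_isSimpleModule F.c_pow_k F.iso (N := N)
  obtain ⟨α, rfl⟩ : ∃ α, α ∘ F.idx = β :=
    ⟨Function.extend F.idx β 1, Function.extend_comp F.idx_injective β 1⟩
  let g : F.Model α →ₗ[K] N := Finsupp.linearCombination K e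
  have hg (x) (v : F.Model α) : g (op (F.iso (QuantumTorus.x _ x)) • v) =
      op (F.iso (QuantumTorus.x _ x)) • g v :=
    (congrArg g (F.op_iso_x_smul α x v)).trans
      (linearCombination_shiftMap (T := Algebra.lsmul K K N (op (F.iso _))) (he x) v)
  let f : F.Model α →ₗ[(QuantumTorus q)ᵐᵒᵖ] N :=
    { g with
      map_smul' := fun a v => by
        have h := QuantumTorus.map_smul_of_map_x_smul (φ := F.iso.toAlgHom) hg
          (F.iso.symm a.unop) v
        rwa [AlgEquiv.toAlgHom_apply, F.iso.apply_symm_apply] at h }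
  refine ⟨α, f, fun hf => he₀ ?_⟩
  have h : Finsupp.linearCombination K e (Finsupp.single 0 1) = e 0 := by
    rw [Finsupp.linearCombination_single, one_smul]
  exact h.symm.trans (LinearMap.congr_fun hf _)

theorem exists_linearEquiv_model [IsAlgClosed K] (hm : 0 < orderOf ζ)
    (hq : ∀ i j, q i j ^ orderOf ζ = 1) (N : Type*) [AddCommGroup N]
    [Module (QuantumTorus q)ᵐᵒᵖ N] [IsSimpleModule (QuantumTorus q)ᵐᵒᵖ N] :
    ∃ α : Fin n → Kˣ, Nonempty (N ≃ₗ[(QuantumTorus q)ᵐᵒᵖ] F.Model α) := by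
  obtain ⟨α, f, hf⟩ := F.exists_linearMap_model_ne_zero hm hq N
  have := F.isSimpleModule_affine α hm
  have := (F.extendsAction_model α).isSimpleModule
  exact ⟨α, ⟨(LinearEquiv.ofBijective f (LinearMap.bijective_of_ne_zero hf)).symm⟩⟩

end NormalForm

end QuantumSpace

end

theorem theoremB {K : Type*} [Field K] [IsAlgClosed K] {n : ℕ} (q : Matrix (Fin n) (Fin n) Kˣ)
    (hq : MultAntisymm q) (hfin : Finite (paramGroup q)) (ζ : Kˣ)
    (hζ : Subgroup.zpowers ζ = paramGroup q) :
    Nonempty (NormalForm q ζ) ∧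
    ∀ F : NormalForm q ζ,
      (∀ (N : Type*) [AddCommGroup N] [Module (QuantumAffine q)ᵐᵒᵖ N]
          [IsSimpleModule (QuantumAffine q)ᵐᵒᵖ N], VariablesActNontrivially q N →
        (∃! _inst : Module (QuantumTorus q)ᵐᵒᵖ N, ExtendsAction q N) ∧
        ∀ [Module (QuantumTorus q)ᵐᵒᵖ N], ExtendsAction q N →
          IsSimpleModule (QuantumTorus q)ᵐᵒᵖ N ∧
          ∃ α : Fin n → Kˣ, Nonempty (N ≃ₗ[(QuantumTorus q)ᵐᵒᵖ] F.Model α)) ∧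
      ∀ α : Fin n → Kˣ, IsSimpleModule (QuantumAffine q)ᵐᵒᵖ (F.Model α) ∧
        VariablesActNontrivially q (F.Model α) := by
  have hm : 0 < orderOf ζ := by
    rw [← hζ] at hfin
    exact orderOf_pos_iff.2 (finite_zpowers.1 hfin)
  have hq_pow (i j) : q i j ^ orderOf ζ = 1 := by
    have h : q i j ∈ Subgroup.zpowers ζ := hζ ▸ Subgroup.subset_closure ⟨(i, j), rfl⟩
    exact orderOf_dvd_iff_pow_eq_one.1 (orderOf_dvd_of_mem_zpowers h)
  refine ⟨nonempty_normalForm hq hm hζ, fun F => ⟨fun N _ _ _ hN => ⟨?_, fun hext => ?_⟩,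
    fun α => ⟨F.isSimpleModule_affine α hm, F.variablesActNontrivially α⟩⟩⟩
  · obtain ⟨M, hM⟩ := exists_extendsAction fun i =>
      (QuantumAffine.isNormalElement_x q i).op.bijective_smul (hN i)
    exact ⟨M, hM, fun M' hM' => ExtendsAction.unique hM' hM⟩
  · have := hext.isSimpleModule
    exact ⟨this, F.exists_linearEquiv_model hm hq_pow N⟩
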